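/- \textbf{Conventions.} A local coefficient system on a space $X$ is a functor $\mathcal F\colon \pi(X)\to\mathsf{Ab}$ from the fundamental groupoid of $X$ to abelian groups; for a continuous map $f\colon X\to Y$ and a system $\mathcal F$ on $Y$, $f^*\mathcal F$ is the composite of $\mathcal F$ with $\pi(f)$, and $H_*(-;-)$ is singular homology with local coefficients. Fix a class $\mathfrak E$ of pairs $(X,\mathcal F)$, with $\mathcal F$ a local coefficient system on $X$, closed under pullbacks: if $f\colon X\to Y$ is continuous, $(Y,\mathcal F)\in\mathfrak E$ and $\mathcal G\cong f^*\mathcal F$, then $(X,\mathcal G)\in\mathfrak E$. A continuous map $f\colon A\to B$ is an \emph{$\mathfrak E$-homology equivalence} if $f_*\colon H_*(A;f^*\mathcal F)\to H_*(B;\mathcal F)$ is an isomorphism for every $\mathcal F$ with $(B,\mathcal F)\in\mathfrak E$. For a continuous map $r\colon Y\to X$ and $U\subseteq X$, let $\mathrm{hofib}_U(r)$ be the space of pairs $(\gamma,y)$ consisting of a path $\gamma\colon[0,1]\to X$ and a point $y\in Y$ with $\gamma(0)\in U$ and $\gamma(1)=r(y)$ (compact-open topology on paths), and let $j\colon r^{-1}(U)\to\mathrm{hofib}_U(r)$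 be the inclusion by constant paths. The map $r$ is a \emph{Leray $\mathfrak E$-homology fibration} if the topology of $X$ has a basis $\mathcal B$ consisting of contractible sets such that for all $x\in U\in\mathcal B$ and every local coefficient system $\mathcal F$ on $\mathrm{hofib}_U(r)$ with $(\mathrm{hofib}_U(r),\mathcal F)\in\mathfrak E$, the inclusion $i\colon r^{-1}(x)\to r^{-1}(U)$ induces an isomorphism $H_*(r^{-1}(x);i^*j^*\mathcal F)\to H_*(r^{-1}(U);j^*\mathcal F)$. \textbf{Lemma.} Let $p_i\colon E_i\to B_i$ ($i=0,1,2$), $g_i\colon E_0\to E_i$ and $f_i\colon B_0\to B_i$ ($i=1,2$) be continuous maps of topological spaces with $p_i\circ g_i=f_i\circ p_0$ for $i=1,2$. Suppose that $p_0,p_1,p_2$ are Leray $\mathfrak E$-homology fibrations, and that for every $b\in B_0$ and $i=1,2$ the restriction $p_0^{-1}(b)\to p_i^{-1}(f_i(b))$ of $g_i$ is an $\mathfrak E$-homology equivalence. Then the map $p\colon E\to B$ induced on double mapping cylinders $$E=E_1\cup_{g_1}(E_0\times[0,1])\cup_{g_2}E_2,\qquad B=B_1\cup_{f_1}(B_0\times[0,1])\cup_{f_2}B_2$$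 (with the quotient topologies, $(x,0)$ being glued to the image of $x$ under the map with index $1$ and $(x,1)$ to its image under the map with index $2$) is a Leray $\mathfrak E$-homology fibration. -/

import Mathlib

universe u

noncomputable section

open CategoryTheory CategoryTheory.Limits

namespace TwistedHomology

/-! ### Local coefficient systems and homology with local coefficients -/

/-- A local coefficient system on `X`: a functor from the fundamental groupoid of `X` to the
category of abelian groups. -/
abbrev LocalSystem (X : Type u) [TopologicalSpace X] :=
  FundamentalGroupoid X ⥤ AddCommGrpCat.{u}

/-- The pullback `f^* F` of a local coefficient system along a continuous map. -/
abbrev LocalSystem.pullback {X Y : Type u} [TopologicalSpace X] [TopologicalSpace Y]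
    (f : C(X, Y)) (F : LocalSystem Y) : LocalSystem X :=
  FundamentalGroupoid.map f ⋙ F

/-- The standard topological simplex `Δⁿ`. -/
abbrev Simplex (n : SimplexCategory) : Type := stdSimplex ℝ (Fin (n.len + 1))

/-- The affine map `|θ| : Δᵐ → Δⁿ` induced by `θ : [m] → [n]`. -/
def simplexMap {m n : SimplexCategory} (θ : m ⟶ n) : C(Simplex m, Simplex n) :=
  ⟨stdSimplex.map θ, stdSimplex.continuous_map θ⟩

/-- The `0`-th vertex of `Δⁿ`. -/
def vertexZero (n : SimplexCategory) : Simplex n := stdSimplex.vertex 0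

instance (n : SimplexCategory) : ContractibleSpace (Simplex n) :=
  (convex_stdSimplex ℝ (Fin (n.len + 1))).contractibleSpace
    ⟨_, (vertexZero n).2⟩

/-- The homotopy class of paths in `Δⁿ` between two points; there is exactly one, as `Δⁿ` is
contractible. -/
def simplexPath {n : SimplexCategory} (a b : Simplex n) :
    FundamentalGroupoid.mk a ⟶ FundamentalGroupoid.mk b :=
  FundamentalGroupoid.fromPath (Path.Homotopic.Quotient.mk (PathConnectedSpace.somePath a b))

theorem simplex_hom_eq {n : SimplexCategory} {a b : FundamentalGroupoid (Simplex n)}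
    (γ γ' : a ⟶ b) : γ = γ' :=
  Subsingleton.elim (α := Path.Homotopic.Quotient a.as b.as) γ γ'

theorem simplexMap_id (n : SimplexCategory) : simplexMap (𝟙 n) = ContinuousMap.id _ := by
  ext x : 1
  exact stdSimplex.map_id_apply x

theorem simplexMap_comp {l m n : SimplexCategory} (θ : l ⟶ m) (η : m ⟶ n) :
    simplexMap (θ ≫ η) = (simplexMap η).comp (simplexMap θ) := by
  refine ContinuousMap.ext fun x => ?_
  exact (stdSimplex.map_comp_apply (⇑θ) (⇑η) x).symm

variable {X : Type u} [TopologicalSpace X]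

/-- The group `⨁_{σ : Δⁿ → X} F(σ(v₀))` of singular `n`-chains with coefficients in `F`. -/
def chainGroup (F : LocalSystem X) (n : SimplexCategory) : AddCommGrpCat.{u} :=
  ∐ fun σ : C(Simplex n, X) => F.obj ⟨σ (vertexZero n)⟩

/-- The inclusion of the summand `F(σ(v₀))` indexed by the singular simplex `σ`. -/
def chainι (F : LocalSystem X) {n : SimplexCategory} (σ : C(Simplex n, X)) :
    F.obj ⟨σ (vertexZero n)⟩ ⟶ chainGroup F n :=
  Sigma.ι (fun σ : C(Simplex n, X) => F.obj ⟨σ (vertexZero n)⟩) σ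

/-- Transport in `F` along the image under `σ : Δⁿ → X` of a path class `γ` in `Δⁿ` from the `0`-th
vertex to the image under `k : Δᵐ → Δⁿ` of the `0`-th vertex of `Δᵐ`. -/
def transport (F : LocalSystem X) {m n : SimplexCategory} (σ : C(Simplex n, X))
    (k : C(Simplex m, Simplex n))
    (γ : FundamentalGroupoid.mk (vertexZero n) ⟶ FundamentalGroupoid.mk (k (vertexZero m))) :
    F.obj ⟨σ (vertexZero n)⟩ ⟶ F.obj ⟨(σ.comp k) (vertexZero m)⟩ :=
  F.map ((FundamentalGroupoid.map σ).map γ)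

/-- The structure map of `θ : [m] → [n]`. It sends the summand of `σ : Δⁿ → X` to that of
`σ ∘ |θ| : Δᵐ → X`, by transport in `F` along the image under `σ` of the path in `Δⁿ` from the
`0`-th vertex to the image under `|θ|` of the `0`-th vertex of `Δᵐ`. -/
def chainMap (F : LocalSystem X) {m n : SimplexCategory} (θ : m ⟶ n) :
    chainGroup F n ⟶ chainGroup F m :=
  Sigma.desc fun σ : C(Simplex n, X) =>
    transport F σ (simplexMap θ) (simplexPath (vertexZero n) (simplexMap θ (vertexZero m))) ≫
      chainι F (σ.comp (simplexMap θ))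

theorem chainι_map (F : LocalSystem X) {m n : SimplexCategory} (θ : m ⟶ n)
    (σ : C(Simplex n, X)) :
    chainι F σ ≫ chainMap F θ =
      transport F σ (simplexMap θ) (simplexPath (vertexZero n) (simplexMap θ (vertexZero m))) ≫
        chainι F (σ.comp (simplexMap θ)) :=
  Sigma.ι_desc _ _

theorem chainGroup_hom_ext (F : LocalSystem X) {n : SimplexCategory} {A : AddCommGrpCat.{u}}
    {a b : chainGroup F n ⟶ A} (h : ∀ σ : C(Simplex n, X), chainι F σ ≫ a = chainι F σ ≫ b) :
    a = b :=
  Sigma.hom_ext _ _ h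

theorem transport_chainι (F : LocalSystem X) {m n : SimplexCategory} (σ : C(Simplex n, X))
    {k k' : C(Simplex m, Simplex n)} (h : k = k')
    (γ : FundamentalGroupoid.mk (vertexZero n) ⟶ FundamentalGroupoid.mk (k (vertexZero m)))
    (γ' : FundamentalGroupoid.mk (vertexZero n) ⟶ FundamentalGroupoid.mk (k' (vertexZero m))) :
    transport F σ k γ ≫ chainι F (σ.comp k) = transport F σ k' γ' ≫ chainι F (σ.comp k') := by
  subst h
  rw [simplex_hom_eq γ γ']

theorem transport_id (F : LocalSystem X) {n : SimplexCategory} (σ : C(Simplex n, X)) :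
    transport F σ (ContinuousMap.id _) (𝟙 (FundamentalGroupoid.mk (vertexZero n))) =
      𝟙 (F.obj ⟨σ (vertexZero n)⟩) :=
  (congrArg F.map ((FundamentalGroupoid.map σ).map_id _)).trans (F.map_id _)

theorem map_map_comp {A B : Type*} [TopologicalSpace A] [TopologicalSpace B]
    (f : C(B, X)) (g : C(A, B)) {x y : FundamentalGroupoid A} (γ : x ⟶ y) :
    (FundamentalGroupoid.map f).map ((FundamentalGroupoid.map g).map γ) =
      (FundamentalGroupoid.map (f.comp g)).map γ := by
  induction γ using Quotient.ind with | _ p => rfl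

theorem transport_comp (F : LocalSystem X) {l m n : SimplexCategory} (σ : C(Simplex n, X))
    (k : C(Simplex m, Simplex n)) (k' : C(Simplex l, Simplex m))
    (γ : FundamentalGroupoid.mk (vertexZero n) ⟶ FundamentalGroupoid.mk (k (vertexZero m)))
    (γ' : FundamentalGroupoid.mk (vertexZero m) ⟶ FundamentalGroupoid.mk (k' (vertexZero l))) :
    transport F σ k γ ≫ transport F (σ.comp k) k' γ' =
      transport F σ (k.comp k') (γ ≫ (FundamentalGroupoid.map k).map γ') := by
  refine Eq.trans ?_ (congrArg F.map ((FundamentalGroupoid.map σ).map_comp γ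
    ((FundamentalGroupoid.map k).map γ'))).symm
  refine Eq.trans ?_ (F.map_comp _ _).symm
  exact congrArg (F.map ((FundamentalGroupoid.map σ).map γ) ≫ ·)
    (congrArg F.map (map_map_comp σ k γ').symm)

theorem chainMap_id (F : LocalSystem X) (n : SimplexCategory) :
    chainMap F (𝟙 n) = 𝟙 (chainGroup F n) := by
  refine chainGroup_hom_ext F fun σ => ?_
  rw [chainι_map, Category.comp_id, transport_chainι F σ (simplexMap_id n) _ (𝟙 _)]
  exact (congrArg (· ≫ chainι F σ) (transport_id F σ)).trans (Category.id_comp _)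

theorem chainMap_comp (F : LocalSystem X) {l m n : SimplexCategory} (θ : l ⟶ m) (η : m ⟶ n) :
    chainMap F (θ ≫ η) = chainMap F η ≫ chainMap F θ := by
  refine chainGroup_hom_ext F fun σ => ?_
  rw [chainι_map, ← Category.assoc, chainι_map, Category.assoc, chainι_map, ← Category.assoc,
    transport_comp]
  exact transport_chainι F σ (simplexMap_comp θ η) _ _

/-- The simplicial abelian group of singular chains of `X` with coefficients in `F`. -/
def singularChains (F : LocalSystem X) : SimplicialObject AddCommGrpCat.{u} where
  obj n := chainGroup F n.unop
  map θ := chainMap F θ.unop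
  map_id n := chainMap_id F n.unop
  map_comp θ η := chainMap_comp F η.unop θ.unop

/-- The chain complex of singular chains of `X` with coefficients in `F`, with differential the
alternating sum of the face maps. -/
def chainComplex (F : LocalSystem X) : ChainComplex AddCommGrpCat.{u} ℕ :=
  (AlgebraicTopology.alternatingFaceMapComplex _).obj (singularChains F)

/-- The homology group `H_n(X; F)`. -/
def homology (F : LocalSystem X) (n : ℕ) : AddCommGrpCat.{u} :=
  (chainComplex F).homology n

variable {Y : Type u} [TopologicalSpace Y]

/-- For `f : X → Y`, the map on chain groups sending the summand `(f^* F)(σ(v₀))` of `σ : Δⁿ → X`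
identically to the summand `F(f(σ(v₀)))` of `f ∘ σ : Δⁿ → Y`. -/
def chainPush (f : C(X, Y)) (F : LocalSystem Y) (n : SimplexCategory) :
    chainGroup (F.pullback f) n ⟶ chainGroup F n :=
  Sigma.desc fun σ : C(Simplex n, X) =>
    (show (F.pullback f).obj ⟨σ (vertexZero n)⟩ ⟶ chainGroup F n from chainι F (f.comp σ))

theorem chainι_push (f : C(X, Y)) (F : LocalSystem Y) {n : SimplexCategory}
    (σ : C(Simplex n, X)) :
    chainι (F.pullback f) σ ≫ chainPush f F n = chainι F (f.comp σ) :=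
  Sigma.ι_desc _ _

theorem chainPush_naturality (f : C(X, Y)) (F : LocalSystem Y) {m n : SimplexCategory}
    (θ : m ⟶ n) :
    chainMap (F.pullback f) θ ≫ chainPush f F m = chainPush f F n ≫ chainMap F θ := by
  refine chainGroup_hom_ext _ fun σ => ?_
  rw [← Category.assoc, ← Category.assoc, chainι_map, Category.assoc, chainι_push]
  refine Eq.trans ?_ (congrArg (· ≫ chainMap F θ) (chainι_push f F σ)).symm
  refine Eq.trans ?_ (chainι_map F θ (f.comp σ)).symm
  exact congrArg (· ≫ chainι F ((f.comp σ).comp (simplexMap θ)))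
    (congrArg F.map (map_map_comp f σ _))

/-- The map of simplicial abelian groups of singular chains induced by `f : X → Y`. -/
def singularChainsMap (f : C(X, Y)) (F : LocalSystem Y) :
    singularChains (F.pullback f) ⟶ singularChains F where
  app n := chainPush f F n.unop
  naturality _ _ θ := chainPush_naturality f F θ.unop

/-- The induced map `f_* : H_n(X; f^* F) → H_n(Y; F)`. -/
def homologyMap (f : C(X, Y)) (F : LocalSystem Y) (n : ℕ) :
    homology (F.pullback f) n ⟶ homology F n :=
  HomologicalComplex.homologyMap
    ((AlgebraicTopology.alternatingFaceMapComplex _).map (singularChainsMap f F)) n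

/-! ### Classes of local coefficient systems -/

/-- A collection of allowable local coefficient systems on topological spaces, closed under
pullbacks. Such a collection is the same as a subcategory of the category of all pairs `(X, F)`
(with morphisms the continuous maps `f` together with an isomorphism from the source system to the
pullback along `f` of the target system) which contains every morphism whose target it contains. -/
structure CoefficientClass where
  /-- `Mem F` says that the pair `(X, F)` is in the collection. -/
  Mem : ∀ {X : Type u} [TopologicalSpace X], LocalSystem X → Prop
  mem_of_iso_pullback : ∀ {X Y : Type u} [TopologicalSpace X] [TopologicalSpace Y]
    (f : C(X, Y)) {G : LocalSystem X} {F : LocalSystem Y},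
    (G ≅ F.pullback f) → Mem F → Mem G

/-- `f : A → B` is a homology equivalence with respect to the class `𝔈`: it induces an isomorphism
`H_*(A; f^* F) → H_*(B; F)` for every local coefficient system `F` on `B` in `𝔈`. -/
def IsHomologyEquivalence (𝔈 : CoefficientClass.{u}) {A B : Type u} [TopologicalSpace A]
    [TopologicalSpace B] (f : C(A, B)) : Prop :=
  ∀ F : LocalSystem B, 𝔈.Mem F → ∀ n : ℕ, IsIso (homologyMap f F n)

/-! ### Leray homology fibrations -/

/-- The homotopy fibre `hofib_U(r)` of `r : Y → X` over `U ⊆ X`: pairs of a path in `X` (with the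
compact-open topology) starting in `U` and a point `y` of `Y` such that the path ends at `r y`. -/
def Hofib (r : C(Y, X)) (U : Set X) : Type u :=
  {q : C(unitInterval, X) × Y // q.1 0 ∈ U ∧ q.1 1 = r q.2}

instance (r : C(Y, X)) (U : Set X) : TopologicalSpace (Hofib r U) :=
  inferInstanceAs (TopologicalSpace {q : C(unitInterval, X) × Y // q.1 0 ∈ U ∧ q.1 1 = r q.2})

/-- The natural inclusion `r⁻¹(U) → hofib_U(r)` by constant paths. -/
def preimageToHofib (r : C(Y, X)) (U : Set X) : C(r ⁻¹' U, Hofib r U) where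
  toFun y := ⟨(ContinuousMap.const _ (r y), y), y.2, rfl⟩
  continuous_toFun := by
    refine Continuous.subtype_mk (Continuous.prodMk ?_ continuous_subtype_val) _
    exact ContinuousMap.continuous_const'.comp (r.continuous.comp continuous_subtype_val)

/-- The inclusion `r⁻¹(x) → r⁻¹(U)` for `x ∈ U`. -/
def fibreInclusion (r : C(Y, X)) {U : Set X} {x : X} (hx : x ∈ U) :
    C(r ⁻¹' {x}, r ⁻¹' U) where
  toFun := Set.inclusion (Set.preimage_mono (Set.singleton_subset_iff.2 hx))
  continuous_toFun := continuous_inclusion _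

/-- `r : Y → X` is a Leray homology fibration with respect to `𝔈`: the topology of `X` has a basis
of contractible sets such that for `x ∈ U` in the basis and `F` a local coefficient system on
`hofib_U(r)` in `𝔈`, with pullback `j^* F` to `r⁻¹(U)`, the inclusion `i : r⁻¹(x) → r⁻¹(U)` induces
an isomorphism `H_*(r⁻¹(x); i^* j^* F) → H_*(r⁻¹(U); j^* F)`. -/
def IsLerayFibration (𝔈 : CoefficientClass.{u}) (r : C(Y, X)) : Prop :=
  ∃ 𝓑 : Set (Set X), TopologicalSpace.IsTopologicalBasis 𝓑 ∧
    (∀ U ∈ 𝓑, ContractibleSpace U) ∧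
    ∀ U ∈ 𝓑, ∀ (x : X) (hx : x ∈ U) (F : LocalSystem (Hofib r U)), 𝔈.Mem F →
      ∀ n : ℕ, IsIso (homologyMap (fibreInclusion r hx) (F.pullback (preimageToHofib r U)) n)

/-! ### Double mapping cylinders -/

section Cylinder

variable {X₀ X₁ X₂ : Type u} [TopologicalSpace X₀] [TopologicalSpace X₁] [TopologicalSpace X₂]

/-- The gluing relation `(x, 0) ∼ f₁ x`, `(x, 1) ∼ f₂ x` on `X₁ ⊔ (X₀ × [0,1]) ⊔ X₂`. -/
inductive CylinderRel (f₁ : C(X₀, X₁)) (f₂ : C(X₀, X₂)) :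
    X₁ ⊕ (X₀ × unitInterval) ⊕ X₂ → X₁ ⊕ (X₀ × unitInterval) ⊕ X₂ → Prop
  | left (x : X₀) : CylinderRel f₁ f₂ (Sum.inr (Sum.inl (x, 0))) (Sum.inl (f₁ x))
  | right (x : X₀) : CylinderRel f₁ f₂ (Sum.inr (Sum.inl (x, 1))) (Sum.inr (Sum.inr (f₂ x)))

/-- The double mapping cylinder `X₁ ∪_{f₁} (X₀ × [0,1]) ∪_{f₂} X₂`, with the quotient topology. -/
def DoubleMappingCylinder (f₁ : C(X₀, X₁)) (f₂ : C(X₀, X₂)) : Type u :=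
  Quot (CylinderRel f₁ f₂)

instance (f₁ : C(X₀, X₁)) (f₂ : C(X₀, X₂)) :
    TopologicalSpace (DoubleMappingCylinder f₁ f₂) :=
  inferInstanceAs (TopologicalSpace (Quot (CylinderRel f₁ f₂)))

end Cylinder

section Square

variable {E₀ E₁ E₂ B₀ B₁ B₂ : Type u}
  [TopologicalSpace E₀] [TopologicalSpace E₁] [TopologicalSpace E₂]
  [TopologicalSpace B₀] [TopologicalSpace B₁] [TopologicalSpace B₂]

/-- The map `p₀⁻¹(b) → p₁⁻¹(f b)` induced by `g` in a commutative square `p₁ ∘ g = f ∘ p₀`. -/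
def fibreMap {p₀ : C(E₀, B₀)} {p₁ : C(E₁, B₁)} {g : C(E₀, E₁)} {f : C(B₀, B₁)}
    (h : p₁.comp g = f.comp p₀) (b : B₀) : C(p₀ ⁻¹' {b}, p₁ ⁻¹' {f b}) where
  toFun e := ⟨g e, (DFunLike.congr_fun h e.1).trans (congrArg f e.2)⟩
  continuous_toFun := (g.continuous.comp continuous_subtype_val).subtype_mk _

/-- The map of double mapping cylinders induced by a map of diagrams; it is `p₁` on `E₁`,
`p₀ × id` on `E₀ × [0,1]` and `p₂` on `E₂`. -/
def cylinderMap {p₀ : C(E₀, B₀)} {p₁ : C(E₁, B₁)} {p₂ : C(E₂, B₂)}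
    {g₁ : C(E₀, E₁)} {g₂ : C(E₀, E₂)} {f₁ : C(B₀, B₁)} {f₂ : C(B₀, B₂)}
    (h₁ : p₁.comp g₁ = f₁.comp p₀) (h₂ : p₂.comp g₂ = f₂.comp p₀) :
    C(DoubleMappingCylinder g₁ g₂, DoubleMappingCylinder f₁ f₂) where
  toFun := Quot.map (Sum.map p₁ (Sum.map (Prod.map p₀ id) p₂)) (by
    rintro _ _ (e | e)
    · have h : p₁ (g₁ e) = f₁ (p₀ e) := DFunLike.congr_fun h₁ e
      simpa only [Sum.map_inl, Sum.map_inr, Prod.map_apply, id, h] using CylinderRel.left (p₀ e)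
    · have h : p₂ (g₂ e) = f₂ (p₀ e) := DFunLike.congr_fun h₂ e
      simpa only [Sum.map_inl, Sum.map_inr, Prod.map_apply, id, h] using CylinderRel.right (p₀ e))
  continuous_toFun := by
    refine continuous_quot_lift _ (continuous_quot_mk.comp ?_)
    exact p₁.continuous.sumMap ((p₀.continuous.prodMap continuous_id).sumMap p₂.continuous)

end Square

end TwistedHomology

end

/-! The Leray condition is local on the base: it suffices that each point of `B` has arbitrarily
small open neighbourhoods satisfying the basis condition (`isLerayFibration_iff`). Such
neighbourhoods are built by collapsing the height coordinate of the cylinders, compatibly on `E` and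
`B`.

Near `(b, c)` with `0 < c < 1`, take `U₀ × (c - ε, c + ε)` with `U₀` a basic set for `p₀`, and
collapse it to height `c`. Every fibre in it is a fibre of `p₀`, carried identically to level `c`.
Near the left end, take a basic set `U₁` for `p₁` together with short vertical segments over
`f₁⁻¹(U₁)`, and push it down to `U₁`. A fibre over positive height is a fibre of `p₀`, and the push
is `g₁`, an `𝔈`-homology equivalence by assumption. The right end follows by exchanging the ends.

`IsLerayOver.of_deformation_retraction` turns such a collapse into the Leray condition: up to
homotopy, the inclusion of a fibre factors as the collapse of fibres, a fibre inclusion already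
known to be good, and a homotopy equivalence. This requires homotopy invariance of homology with
local coefficients, proved with prism operators (`prismHomotopy`). The coefficients stay admissible
because a map of squares induces a map of homotopy fibres and `𝔈` is closed under pullback. -/

noncomputable section

open CategoryTheory CategoryTheory.Limits

namespace TwistedHomology

/-! ### Functoriality of twisted homology in the coefficients and in the space -/

section Coefficients

variable {X Y Z : Type u} [TopologicalSpace X] [TopologicalSpace Y] [TopologicalSpace Z]

/-- The map on chain groups induced by a morphism of local coefficient systems. -/
def chainCoeff {F G : LocalSystem X} (α : F ⟶ G) (n : SimplexCategory) :
    chainGroup F n ⟶ chainGroup G n :=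
  Sigma.desc fun σ : C(Simplex n, X) => α.app ⟨σ (vertexZero n)⟩ ≫ chainι G σ

theorem chainι_coeff {F G : LocalSystem X} (α : F ⟶ G) {n : SimplexCategory}
    (σ : C(Simplex n, X)) :
    chainι F σ ≫ chainCoeff α n = α.app ⟨σ (vertexZero n)⟩ ≫ chainι G σ :=
  Sigma.ι_desc _ _

theorem chainCoeff_naturality {F G : LocalSystem X} (α : F ⟶ G) {m n : SimplexCategory}
    (θ : m ⟶ n) : chainMap F θ ≫ chainCoeff α m = chainCoeff α n ≫ chainMap G θ := by
  refine chainGroup_hom_ext _ fun σ => ?_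
  rw [← Category.assoc, ← Category.assoc, chainι_map, chainι_coeff, Category.assoc,
    Category.assoc, chainι_coeff, chainι_map, ← Category.assoc, ← Category.assoc]
  exact congrArg (· ≫ chainι G (σ.comp (simplexMap θ))) (α.naturality _)

/-- The map of simplicial abelian groups of singular chains induced by a morphism of local
coefficient systems. -/
def singularChainsCoeff {F G : LocalSystem X} (α : F ⟶ G) :
    singularChains F ⟶ singularChains G where
  app n := chainCoeff α n.unop
  naturality _ _ θ := chainCoeff_naturality α θ.unop

theorem singularChainsCoeff_id (F : LocalSystem X) :
    singularChainsCoeff (𝟙 F) = 𝟙 (singularChains F) := by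
  refine NatTrans.ext (funext fun n => ?_)
  refine chainGroup_hom_ext F fun σ => (chainι_coeff _ σ).trans ?_
  exact (Category.id_comp _).trans (Category.comp_id _).symm

theorem singularChainsCoeff_comp {F G H : LocalSystem X} (α : F ⟶ G) (β : G ⟶ H) :
    singularChainsCoeff (α ≫ β) = singularChainsCoeff α ≫ singularChainsCoeff β := by
  refine NatTrans.ext (funext fun n => ?_)
  refine chainGroup_hom_ext F fun σ => (chainι_coeff _ σ).trans ?_
  refine Eq.trans ?_ (Category.assoc _ _ _)
  refine Eq.trans ?_ (congrArg (· ≫ chainCoeff β n.unop) (chainι_coeff α σ)).symm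
  rw [Category.assoc, chainι_coeff, ← Category.assoc]
  rfl

/-- The `n`-th homology group of a simplicial abelian group, as a functor. -/
def simplicialHomology (n : ℕ) : SimplicialObject AddCommGrpCat.{u} ⥤ AddCommGrpCat.{u} :=
  AlgebraicTopology.alternatingFaceMapComplex _ ⋙ HomologicalComplex.homologyFunctor _ _ n

/-- The map `H_n(X; F) → H_n(X; G)` induced by a morphism `F ⟶ G`. -/
def homologyCoeff {F G : LocalSystem X} (α : F ⟶ G) (n : ℕ) : homology F n ⟶ homology G n :=
  (simplicialHomology n).map (singularChainsCoeff α)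

theorem homologyCoeff_id (F : LocalSystem X) (n : ℕ) :
    homologyCoeff (𝟙 F) n = 𝟙 (homology F n) :=
  (congrArg (simplicialHomology n).map (singularChainsCoeff_id F)).trans
    ((simplicialHomology n).map_id _)

theorem homologyCoeff_comp {F G H : LocalSystem X} (α : F ⟶ G) (β : G ⟶ H) (n : ℕ) :
    homologyCoeff (α ≫ β) n = homologyCoeff α n ≫ homologyCoeff β n :=
  (congrArg (simplicialHomology n).map (singularChainsCoeff_comp α β)).trans
    ((simplicialHomology n).map_comp _ _)

instance {F G : LocalSystem X} (α : F ⟶ G) [IsIso α] (n : ℕ) : IsIso (homologyCoeff α n) :=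
  ⟨homologyCoeff (inv α) n, by rw [← homologyCoeff_comp, IsIso.hom_inv_id, homologyCoeff_id],
    by rw [← homologyCoeff_comp, IsIso.inv_hom_id, homologyCoeff_id]⟩

theorem singularChainsMap_naturality (f : C(X, Y)) {F G : LocalSystem Y} (α : F ⟶ G) :
    singularChainsCoeff (Functor.whiskerLeft (FundamentalGroupoid.map f) α) ≫
        singularChainsMap f G =
      singularChainsMap f F ≫ singularChainsCoeff α := by
  refine NatTrans.ext (funext fun n => ?_)
  refine chainGroup_hom_ext (F.pullback f) fun σ => ?_
  refine (Category.assoc _ _ _).symm.trans (Eq.trans ?_ (Category.assoc _ _ _))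
  refine Eq.trans (congrArg (· ≫ chainPush f G n.unop)
    (chainι_coeff (Functor.whiskerLeft (FundamentalGroupoid.map f) α) σ)) ?_
  refine Eq.trans ?_ (congrArg (· ≫ chainCoeff α n.unop) (chainι_push f F σ)).symm
  refine Eq.trans ?_ (chainι_coeff α (f.comp σ)).symm
  refine (Category.assoc _ _ _).trans ?_
  exact congrArg (α.app ⟨f (σ (vertexZero n.unop))⟩ ≫ ·) (chainι_push f G σ)

/-- Pullback along a composite is the iterated pullback. -/
def LocalSystem.pullbackComp (f : C(Y, Z)) (g : C(X, Y)) (F : LocalSystem Z) :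
    F.pullback (f.comp g) ≅ (F.pullback f).pullback g :=
  NatIso.ofComponents (fun x => Iso.refl (F.obj ⟨f (g x.as)⟩)) fun γ =>
    ((Category.comp_id _).trans (congrArg F.map (map_map_comp f g γ).symm)).trans
      (Category.id_comp _).symm

theorem map_id_map {x y : FundamentalGroupoid X} (γ : x ⟶ y) :
    (FundamentalGroupoid.map (ContinuousMap.id X)).map γ = γ := by
  induction γ using Quotient.ind with | _ p => rfl

/-- Pullback along the identity. -/
def LocalSystem.pullbackId (F : LocalSystem X) : F.pullback (ContinuousMap.id X) ≅ F :=
  NatIso.ofComponents (fun x => Iso.refl (F.obj x)) fun γ =>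
    ((Category.comp_id _).trans (congrArg F.map (map_id_map γ))).trans
      (Category.id_comp _).symm

/-- The coefficients on the two sides are matched by the canonical isomorphism `pullbackComp`. On
each summand it is the identity, so both sides send the summand of `σ` to that of `f ∘ g ∘ σ`. -/
theorem singularChainsMap_comp (f : C(Y, Z)) (g : C(X, Y)) (F : LocalSystem Z) :
    singularChainsMap (f.comp g) F =
      singularChainsCoeff (F.pullbackComp f g).hom ≫
        singularChainsMap g (F.pullback f) ≫ singularChainsMap f F := by
  refine NatTrans.ext (funext fun n => ?_)
  refine chainGroup_hom_ext (F.pullback (f.comp g)) fun σ => ?_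
  refine (chainι_push (f.comp g) F σ).trans ?_
  refine Eq.trans ?_ (Category.assoc _ _ _)
  refine Eq.trans ?_ (congrArg (· ≫ (chainPush g (F.pullback f) n.unop ≫ chainPush f F n.unop))
    (chainι_coeff (F.pullbackComp f g).hom σ)).symm
  refine Eq.trans ?_ (congrArg (· ≫ (chainPush g (F.pullback f) n.unop ≫ chainPush f F n.unop))
    (Category.id_comp (chainι ((F.pullback f).pullback g) σ))).symm
  refine Eq.trans ?_ (Category.assoc _ _ _)
  refine Eq.trans ?_ (congrArg (· ≫ chainPush f F n.unop) (chainι_push g (F.pullback f) σ)).symm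
  exact (chainι_push f F (g.comp σ)).symm

theorem singularChainsMap_id (F : LocalSystem X) :
    singularChainsMap (ContinuousMap.id X) F =
      singularChainsCoeff F.pullbackId.hom := by
  refine NatTrans.ext (funext fun n => ?_)
  refine chainGroup_hom_ext (F.pullback (ContinuousMap.id X)) fun σ => ?_
  refine (chainι_push (ContinuousMap.id X) F σ).trans ?_
  refine Eq.trans ?_ (chainι_coeff F.pullbackId.hom σ).symm
  exact (Category.id_comp (chainι F σ)).symm

/-- `f` induces isomorphisms `H_n(X; f^* F) → H_n(Y; F)` for all `n`. -/
def InducesIso (f : C(X, Y)) (F : LocalSystem Y) : Prop :=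
  ∀ n : ℕ, IsIso (homologyMap f F n)

theorem homologyMap_naturality (f : C(X, Y)) {F G : LocalSystem Y} (α : F ⟶ G) (n : ℕ) :
    homologyCoeff (F := F.pullback f) (G := G.pullback f)
        (Functor.whiskerLeft (FundamentalGroupoid.map f) α) n ≫ homologyMap f G n =
      homologyMap f F n ≫ homologyCoeff α n :=
  ((simplicialHomology n).map_comp _ _).symm.trans
    ((congrArg (simplicialHomology n).map (singularChainsMap_naturality f α)).trans
      ((simplicialHomology n).map_comp _ _))

theorem homologyMap_comp (f : C(Y, Z)) (g : C(X, Y)) (F : LocalSystem Z) (n : ℕ) :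
    homologyMap (f.comp g) F n =
      homologyCoeff (F.pullbackComp f g).hom n ≫
        homologyMap g (F.pullback f) n ≫ homologyMap f F n :=
  (congrArg (simplicialHomology n).map (singularChainsMap_comp f g F)).trans
    (((simplicialHomology n).map_comp _ _).trans
      (congrArg (homologyCoeff (F.pullbackComp f g).hom n ≫ ·)
        ((simplicialHomology n).map_comp _ _)))

theorem homologyMap_id (F : LocalSystem X) (n : ℕ) :
    homologyMap (ContinuousMap.id X) F n = homologyCoeff F.pullbackId.hom n :=
  congrArg (simplicialHomology n).map (singularChainsMap_id F)

theorem InducesIso.of_iso {f : C(X, Y)} {F G : LocalSystem Y} (α : F ≅ G)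
    (h : InducesIso f F) : InducesIso f G := by
  intro n
  have := h n
  have e := homologyMap_naturality f α.hom n
  have h1 : IsIso (homologyMap f F n ≫ homologyCoeff α.hom n) := inferInstance
  rw [← e] at h1
  exact IsIso.of_isIso_comp_left (homologyCoeff (F := F.pullback f) (G := G.pullback f)
    (Functor.whiskerLeft (FundamentalGroupoid.map f) α.hom) n) _

theorem InducesIso.comp {f : C(Y, Z)} {g : C(X, Y)} {F : LocalSystem Z}
    (hf : InducesIso f F) (hg : InducesIso g (F.pullback f)) : InducesIso (f.comp g) F := by
  intro n
  have := hf n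
  have := hg n
  rw [homologyMap_comp]
  infer_instance

/-- Two-out-of-three: the outer map is an isomorphism once the composite and the inner map are. -/
theorem InducesIso.of_comp_right {f : C(Y, Z)} {g : C(X, Y)} {F : LocalSystem Z}
    (h : InducesIso (f.comp g) F) (hg : InducesIso g (F.pullback f)) : InducesIso f F := by
  intro n
  have h1 := h n
  have := hg n
  rw [homologyMap_comp, ← Category.assoc] at h1
  exact IsIso.of_isIso_comp_left
    (homologyCoeff (F.pullbackComp f g).hom n ≫ homologyMap g (F.pullback f) n) _

theorem inducesIso_id (F : LocalSystem X) : InducesIso (ContinuousMap.id X) F := by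
  intro n
  rw [homologyMap_id]
  infer_instance

end Coefficients

/-! ### Affine simplices in the prism and their action on chains -/

section Prism

instance : ContractibleSpace unitInterval :=
  (convex_Icc (0 : ℝ) 1).contractibleSpace ⟨0, unitInterval.zero_mem⟩

/-- The prism `[0,1] × Δⁿ`. -/
abbrev Prism (n : SimplexCategory) : Type := unitInterval × Simplex n

instance (n : SimplexCategory) : ContractibleSpace (Prism n) :=
  inferInstanceAs (ContractibleSpace (unitInterval × Simplex n))

/-- The base vertex `(0, v₀)` of the prism. -/
abbrev prismBase (n : SimplexCategory) : Prism n := (0, vertexZero n)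

/-- The unique class of paths between two points of the prism. -/
def prismPath {n : SimplexCategory} (a b : Prism n) :
    FundamentalGroupoid.mk a ⟶ FundamentalGroupoid.mk b :=
  FundamentalGroupoid.fromPath (Path.Homotopic.Quotient.mk (PathConnectedSpace.somePath a b))

/-- The prism is contractible, hence simply connected. Every coherence question about transport
below is settled by comparing path classes here, before mapping them to the target space. -/
theorem prism_hom_eq {n : SimplexCategory} {a b : FundamentalGroupoid (Prism n)}
    (γ γ' : a ⟶ b) : γ = γ' :=
  Subsingleton.elim (α := Path.Homotopic.Quotient a.as b.as) γ γ'

/-- The inclusion `Δᵐ → [0,1] × Δⁿ` which is affine on the vertices, where it is given by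
`a : [m] → {0, 1}` and `θ : [m] → [n]`. -/
def prismSimplex {m n : SimplexCategory} (a : Fin (m.len + 1) → Fin 2) (θ : m ⟶ n) :
    C(Simplex m, Prism n) where
  toFun x := (stdSimplexHomeomorphUnitInterval (stdSimplex.map a x), simplexMap θ x)
  continuous_toFun := (stdSimplexHomeomorphUnitInterval.continuous.comp
    (stdSimplex.continuous_map a)).prodMk (simplexMap θ).continuous

theorem prismSimplex_comp {l m n : SimplexCategory} (a : Fin (m.len + 1) → Fin 2) (θ : m ⟶ n)
    (η : l ⟶ m) :
    (prismSimplex a θ).comp (simplexMap η) = prismSimplex (a ∘ η) (η ≫ θ) := by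
  refine ContinuousMap.ext fun x => Prod.ext ?_ ?_
  · exact congrArg stdSimplexHomeomorphUnitInterval (stdSimplex.map_comp_apply (⇑η) a x)
  · exact (DFunLike.congr_fun (simplexMap_comp η θ) x).symm

/-- The map `[0,1] × σ`. -/
abbrev prismMap {X Y : Type*} [TopologicalSpace X] [TopologicalSpace Y] (f : C(X, Y)) :
    C(unitInterval × X, unitInterval × Y) :=
  (ContinuousMap.id unitInterval).prodMap f

theorem prismMap_comp_prismSimplex {l m n : SimplexCategory} (a : Fin (l.len + 1) → Fin 2)
    (η : l ⟶ m) (θ : m ⟶ n) :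
    (prismMap (simplexMap θ)).comp (prismSimplex a η) = prismSimplex a (η ≫ θ) := by
  refine ContinuousMap.ext fun x => Prod.ext rfl ?_
  exact (DFunLike.congr_fun (simplexMap_comp η θ) x).symm

/-- A constant map of vertices factors through the `0`-simplex, which is a point. -/
theorem stdSimplex_map_const {m : SimplexCategory} (i : Fin 2) (x : Simplex m) :
    stdSimplex.map (fun _ => i) x = stdSimplex.vertex (S := ℝ) i := by
  rw [show (fun _ : Fin (m.len + 1) => i) = (fun _ : Fin 1 => i) ∘ fun _ => 0 from rfl,
    ← stdSimplex.map_comp_apply,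
    Subsingleton.elim (stdSimplex.map (fun _ => (0 : Fin 1)) x) (stdSimplex.vertex 0),
    stdSimplex.map_vertex]

theorem prismSimplex_zero (n : SimplexCategory) :
    prismSimplex (fun _ => 0) (𝟙 n) = (ContinuousMap.const _ 0).prodMk (ContinuousMap.id _) := by
  refine ContinuousMap.ext fun x => Prod.ext ?_ (DFunLike.congr_fun (simplexMap_id n) x)
  exact (congrArg stdSimplexHomeomorphUnitInterval (stdSimplex_map_const 0 x)).trans
    stdSimplexHomeomorphUnitInterval_zero

theorem prismSimplex_one (n : SimplexCategory) :
    prismSimplex (fun _ => 1) (𝟙 n) = (ContinuousMap.const _ 1).prodMk (ContinuousMap.id _) := by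
  refine ContinuousMap.ext fun x => Prod.ext ?_ (DFunLike.congr_fun (simplexMap_id n) x)
  exact (congrArg stdSimplexHomeomorphUnitInterval (stdSimplex_map_const 1 x)).trans
    stdSimplexHomeomorphUnitInterval_one

variable {X : Type u} [TopologicalSpace X]

variable (X) in
/-- The inclusion `X → [0,1] × X` at height `t`. -/
def cylInclusion (t : unitInterval) : C(X, unitInterval × X) :=
  (ContinuousMap.const _ t).prodMk (ContinuousMap.id _)

/-- Transport in `F` along the image under `[0,1] × σ` of a path class in the prism. -/
def prismTransport (F : LocalSystem (unitInterval × X)) {m n : SimplexCategory}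
    (σ : C(Simplex n, X)) (k : C(Simplex m, Prism n))
    (γ : FundamentalGroupoid.mk (prismBase n) ⟶ FundamentalGroupoid.mk (k (vertexZero m))) :
    (F.pullback (cylInclusion X 0)).obj ⟨σ (vertexZero n)⟩ ⟶
      F.obj ⟨((prismMap σ).comp k) (vertexZero m)⟩ :=
  F.map ((FundamentalGroupoid.map (prismMap σ)).map γ)

/-- The map on chains induced by an affine simplex in the prism. -/
def prismPush (F : LocalSystem (unitInterval × X)) {m n : SimplexCategory}
    (k : C(Simplex m, Prism n)) :
    chainGroup (F.pullback (cylInclusion X 0)) n ⟶ chainGroup F m :=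
  Sigma.desc fun σ : C(Simplex n, X) =>
    prismTransport F σ k (prismPath (prismBase n) (k (vertexZero m))) ≫
      chainι F ((prismMap σ).comp k)

theorem chainι_prismPush (F : LocalSystem (unitInterval × X)) {m n : SimplexCategory}
    (k : C(Simplex m, Prism n)) (σ : C(Simplex n, X)) :
    chainι (F.pullback (cylInclusion X 0)) σ ≫ prismPush F k =
      prismTransport F σ k (prismPath (prismBase n) (k (vertexZero m))) ≫
        chainι F ((prismMap σ).comp k) :=
  Sigma.ι_desc _ _

/-- With `chainMap_prismPush`, this reduces the simplicial homotopy identities to identities between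
affine simplices of the prism, that is, between pairs of a height function and a simplicial
operator. -/
theorem prismPush_chainMap (F : LocalSystem (unitInterval × X)) {l m n : SimplexCategory}
    (k : C(Simplex m, Prism n)) (θ : l ⟶ m) :
    prismPush F k ≫ chainMap F θ = prismPush F (k.comp (simplexMap θ)) := by
  refine chainGroup_hom_ext _ fun σ => ?_
  rw [← Category.assoc, chainι_prismPush, chainι_prismPush, Category.assoc, chainι_map,
    ← Category.assoc]
  refine congrArg (· ≫ chainι F ((prismMap σ).comp (k.comp (simplexMap θ)))) ?_
  refine (F.map_comp _ _).symm.trans (congrArg F.map ?_)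
  refine Eq.trans ?_ (congrArg (FundamentalGroupoid.map (prismMap σ)).map
    (prism_hom_eq (prismPath (prismBase n) (k (vertexZero m)) ≫
      (FundamentalGroupoid.map k).map (simplexPath (vertexZero m)
        (simplexMap θ (vertexZero l)))) _))
  refine Eq.trans ?_ ((FundamentalGroupoid.map (prismMap σ)).map_comp
    (prismPath (prismBase n) (k (vertexZero m))) ((FundamentalGroupoid.map k).map
      (simplexPath (vertexZero m) (simplexMap θ (vertexZero l))))).symm
  exact congrArg ((FundamentalGroupoid.map (prismMap σ)).map
    (prismPath (prismBase n) (k (vertexZero m))) ≫ ·) (map_map_comp (prismMap σ) k _).symm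

theorem chainMap_prismPush (F : LocalSystem (unitInterval × X)) {l m n : SimplexCategory}
    (θ : m ⟶ n) (k : C(Simplex l, Prism m)) :
    chainMap (F.pullback (cylInclusion X 0)) θ ≫ prismPush F k =
      prismPush F ((prismMap (simplexMap θ)).comp k) := by
  refine chainGroup_hom_ext _ fun σ => ?_
  rw [← Category.assoc, chainι_map, Category.assoc, chainι_prismPush, chainι_prismPush,
    ← Category.assoc]
  refine congrArg (· ≫ chainι F ((prismMap (σ.comp (simplexMap θ))).comp k)) ?_
  refine (F.map_comp _ _).symm.trans (congrArg F.map ?_)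
  have e := prism_hom_eq
    ((FundamentalGroupoid.map (cylInclusion (Simplex n) 0)).map
        (simplexPath (vertexZero n) (simplexMap θ (vertexZero m))) ≫
      (FundamentalGroupoid.map (prismMap (simplexMap θ))).map
        (prismPath (prismBase m) (k (vertexZero l))))
    (prismPath (prismBase n) (((prismMap (simplexMap θ)).comp k) (vertexZero l)))
  refine Eq.trans ?_ (congrArg (FundamentalGroupoid.map (prismMap σ)).map e)
  refine Eq.trans ?_ ((FundamentalGroupoid.map (prismMap σ)).map_comp
    ((FundamentalGroupoid.map (cylInclusion (Simplex n) 0)).map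
        (simplexPath (vertexZero n) (simplexMap θ (vertexZero m))))
    ((FundamentalGroupoid.map (prismMap (simplexMap θ))).map
        (prismPath (prismBase m) (k (vertexZero l))))).symm
  refine congrArg₂ (· ≫ ·) ?_ (map_map_comp (prismMap σ) (prismMap (simplexMap θ)) _).symm
  exact (map_map_comp (cylInclusion X 0) σ _).trans
    (map_map_comp (prismMap σ) (cylInclusion (Simplex n) 0) _).symm

theorem prismPush_zero (F : LocalSystem (unitInterval × X)) (n : SimplexCategory) :
    prismPush F (prismSimplex (fun _ => 0) (𝟙 n)) = chainPush (cylInclusion X 0) F n := by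
  rw [prismSimplex_zero]
  refine chainGroup_hom_ext _ fun σ => ?_
  rw [chainι_push, chainι_prismPush]
  refine Eq.trans (congrArg (· ≫ chainι F ((cylInclusion X 0).comp σ)) ?_) (Category.id_comp _)
  refine Eq.trans (congrArg (prismTransport F σ _) (prism_hom_eq _ (𝟙 (.mk (prismBase n))))) ?_
  exact (congrArg F.map ((FundamentalGroupoid.map (prismMap σ)).map_id _)).trans (F.map_id _)

/-- The canonical homotopy from the bottom to the top inclusion `X → [0,1] × X`. -/
def cylHomotopy (X : Type u) [TopologicalSpace X] :
    ContinuousMap.Homotopy (cylInclusion X 0) (cylInclusion X 1) where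
  toContinuousMap := ContinuousMap.id _
  map_zero_left _ := rfl
  map_one_left _ := rfl

/-- Transport along the cylinder. -/
def cylTransport (F : LocalSystem (unitInterval × X)) :
    F.pullback (cylInclusion X 0) ⟶ F.pullback (cylInclusion X 1) :=
  Functor.whiskerRight (FundamentalGroupoidFunctor.homotopicMapsNatIso (cylHomotopy X)) F

instance (F : LocalSystem (unitInterval × X)) : IsIso (cylTransport F) := by
  unfold cylTransport
  infer_instance

theorem prismPush_one (F : LocalSystem (unitInterval × X)) (n : SimplexCategory) :
    prismPush F (prismSimplex (fun _ => 1) (𝟙 n)) =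
      chainCoeff (cylTransport F) n ≫ chainPush (cylInclusion X 1) F n := by
  rw [prismSimplex_one]
  refine chainGroup_hom_ext _ fun σ => ?_
  rw [← Category.assoc, chainι_coeff, Category.assoc, chainι_push, chainι_prismPush]
  refine congrArg (· ≫ chainι F ((cylInclusion X 1).comp σ)) ?_
  -- The path from `(0, v₀)` to `(1, v₀)` may be taken to be the vertical edge, whose image is the
  -- track along which `cylTransport` is defined.
  refine Eq.trans (congrArg (prismTransport F σ _) (prism_hom_eq _
    (FundamentalGroupoid.fromPath (Path.Homotopic.Quotient.mk
      ((cylHomotopy (Simplex n)).evalAt (vertexZero n)))))) ?_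
  refine congrArg F.map ?_
  rfl

end Prism

/-! ### Prism operators and homotopy invariance -/

section HomotopyInvariance

open Simplicial

variable {X Y : Type u} [TopologicalSpace X] [TopologicalSpace Y]

/-- The heights of the vertices of the `i`-th simplex of the prism decomposition. -/
def prismHeight {n : ℕ} (i : Fin (n + 1)) (j : Fin (n + 2)) : Fin 2 :=
  if j ≤ i.castSucc then 0 else 1

/-- The `i`-th prism operator. -/
def prismOperator (F : LocalSystem (unitInterval × X)) {n : ℕ} (i : Fin (n + 1)) :
    chainGroup (F.pullback (cylInclusion X 0)) ⦋n⦌ ⟶ chainGroup F ⦋n + 1⦌ :=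
  prismPush F (prismSimplex (m := ⦋n + 1⦌) (prismHeight i) (SimplexCategory.σ i))

theorem prismOperator_chainMap (F : LocalSystem (unitInterval × X)) {n : ℕ} (i : Fin (n + 1))
    {m : SimplexCategory} (θ : m ⟶ ⦋n + 1⦌) :
    prismOperator F i ≫ chainMap F θ =
      prismPush F (prismSimplex (prismHeight i ∘ θ) (θ ≫ SimplexCategory.σ i)) := by
  rw [prismOperator, prismPush_chainMap, prismSimplex_comp]

theorem chainMap_prismOperator (F : LocalSystem (unitInterval × X)) {n : ℕ} (i : Fin (n + 1))
    {m : SimplexCategory} (θ : ⦋n⦌ ⟶ m) :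
    chainMap (F.pullback (cylInclusion X 0)) θ ≫ prismOperator F i =
      prismPush F (prismSimplex (m := ⦋n + 1⦌) (prismHeight i) (SimplexCategory.σ i ≫ θ)) := by
  rw [prismOperator, chainMap_prismPush, prismMap_comp_prismSimplex]

theorem prismPush_congr (F : LocalSystem (unitInterval × X)) {m n : SimplexCategory}
    {a b : Fin (m.len + 1) → Fin 2} {θ η : m ⟶ n} (h : a = b) (h' : θ = η) :
    prismPush F (prismSimplex a θ) = prismPush F (prismSimplex b η) := by
  rw [h, h']

theorem prismHeight_δ_of_le {n : ℕ} (i : Fin (n + 2)) (j : Fin (n + 1)) (h : i ≤ j.castSucc) :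
    prismHeight j.succ ∘ i.castSucc.succAbove = prismHeight j := by
  funext k
  simp only [prismHeight, Function.comp_apply, Fin.succAbove, Fin.le_def, Fin.lt_def] at h ⊢
  grind

theorem prismHeight_δ_of_lt {n : ℕ} (i : Fin (n + 2)) (j : Fin (n + 1)) (h : j.castSucc < i) :
    prismHeight j.castSucc ∘ i.succ.succAbove = prismHeight j := by
  funext k
  simp only [prismHeight, Function.comp_apply, Fin.succAbove, Fin.le_def, Fin.lt_def] at h ⊢
  grind

theorem prismHeight_σ_of_le {n : ℕ} (i j : Fin (n + 1)) (h : i ≤ j) :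
    prismHeight j ∘ i.castSucc.predAbove = prismHeight j.succ := by
  funext k
  refine if_congr ?_ rfl rfl
  simp only [Fin.predAbove, Fin.le_def, Fin.lt_def] at h ⊢
  split_ifs with hk
  · simp at hk ⊢
  · simp at hk ⊢
    omega

theorem prismHeight_σ_of_ge {n : ℕ} (i j : Fin (n + 1)) (h : j ≤ i) :
    prismHeight j ∘ i.succ.predAbove = prismHeight j.castSucc := by
  funext k
  refine if_congr ?_ rfl rfl
  simp only [Fin.predAbove, Fin.le_def, Fin.lt_def] at h ⊢
  split_ifs with hk
  · simp at hk ⊢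
    omega
  · simp at hk ⊢

/-- The prism operators form a simplicial homotopy between the maps induced by the bottom
inclusion, and by transport along the cylinder followed by the top inclusion. -/
def prismHomotopy (F : LocalSystem (unitInterval × X)) :
    SimplicialObject.Homotopy (singularChainsMap (cylInclusion X 0) F)
      (singularChainsCoeff (cylTransport F) ≫ singularChainsMap (cylInclusion X 1) F) where
  h i := prismOperator F i
  h_zero_comp_δ_zero n := by
    refine Eq.trans ?_ (prismPush_one F ⦋n⦌)
    refine (prismOperator_chainMap F 0 (SimplexCategory.δ 0)).trans (prismPush_congr F ?_ ?_)
    -- The `0`-th simplex has a single vertex at height `0`, its initial one, which this face omits.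
    · funext k
      exact if_neg (t := 0) (show ¬(0 : Fin (n + 2)).succAbove k ≤ Fin.castSucc 0 by simp)
    · exact SimplexCategory.δ_comp_σ_self
  h_last_comp_δ_last n := by
    refine Eq.trans ?_ (prismPush_zero F ⦋n⦌)
    refine (prismOperator_chainMap F (Fin.last n) (SimplexCategory.δ (Fin.last _))).trans
      (prismPush_congr F ?_ ?_)
    -- Dually, the last simplex has a single vertex at height `1`, its final one.
    · funext k
      refine if_pos ?_
      change (Fin.last (n + 1)).succAbove k ≤ _
      rw [Fin.succAbove_last]
      exact Fin.castSucc_le_castSucc_iff.2 (Fin.le_last k)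
    · exact SimplexCategory.δ_comp_σ_succ
  h_succ_comp_δ_castSucc_of_lt i j hij :=
    (prismOperator_chainMap F j.succ (SimplexCategory.δ i.castSucc)).trans
      ((prismPush_congr F (prismHeight_δ_of_le i j hij)
        (SimplexCategory.δ_comp_σ_of_le hij)).trans
          (chainMap_prismOperator F j (SimplexCategory.δ i)).symm)
  h_succ_comp_δ_castSucc_succ j := by
    refine (prismOperator_chainMap F j.succ (SimplexCategory.δ j.castSucc.succ)).trans
      (Eq.trans (prismPush_congr F ?_ ?_)
        (prismOperator_chainMap F j.castSucc (SimplexCategory.δ j.castSucc.succ)).symm)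
    -- Consecutive simplices share this face: their height functions differ only at the vertex `j +
    -- 1`, which is omitted.
    · funext k
      change prismHeight j.succ (Fin.succAbove _ k) = prismHeight j.castSucc (Fin.succAbove _ k)
      simp only [prismHeight, Fin.succAbove, Fin.le_def, Fin.lt_def]
      grind
    · exact (SimplexCategory.δ_comp_σ_self (i := j.succ)).trans
        (SimplexCategory.δ_comp_σ_succ (i := j.castSucc)).symm
  h_castSucc_comp_δ_succ_of_lt i j hji :=
    (prismOperator_chainMap F j.castSucc (SimplexCategory.δ i.succ)).trans
      ((prismPush_congr F (prismHeight_δ_of_lt i j hji)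
        (SimplexCategory.δ_comp_σ_of_gt hji)).trans
          (chainMap_prismOperator F j (SimplexCategory.δ i)).symm)
  h_comp_σ_castSucc_of_le i j hij :=
    (prismOperator_chainMap F j (SimplexCategory.σ i.castSucc)).trans
      ((prismPush_congr F (prismHeight_σ_of_le i j hij)
        (SimplexCategory.σ_comp_σ hij)).trans
          (chainMap_prismOperator F j.succ (SimplexCategory.σ i)).symm)
  h_comp_σ_succ_of_lt i j hji :=
    (prismOperator_chainMap F j (SimplexCategory.σ i.succ)).trans
      ((prismPush_congr F (prismHeight_σ_of_ge i j hji)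
        (SimplexCategory.σ_comp_σ hji).symm).trans
          (chainMap_prismOperator F j.castSucc (SimplexCategory.σ i)).symm)

theorem homologyMap_cylInclusion (F : LocalSystem (unitInterval × X)) (n : ℕ) :
    homologyMap (cylInclusion X 0) F n =
      homologyCoeff (cylTransport F) n ≫ homologyMap (cylInclusion X 1) F n :=
  ((prismHomotopy F).map_homology_eq n).trans ((simplicialHomology n).map_comp _ _)

/-- Homotopy invariance of homology with local coefficients. -/
theorem exists_homologyMap_eq_of_homotopic {f g : C(X, Y)} (h : f.Homotopic g)
    (F : LocalSystem Y) (n : ℕ) :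
    ∃ e : homology (F.pullback f) n ≅ homology (F.pullback g) n,
      homologyMap f F n = e.hom ≫ homologyMap g F n := by
  obtain ⟨H⟩ := h
  have h₀ : H.toContinuousMap.comp (cylInclusion X 0) = f := ContinuousMap.ext H.map_zero_left
  have h₁ : H.toContinuousMap.comp (cylInclusion X 1) = g := ContinuousMap.ext H.map_one_left
  -- Forgetting that `K` comes from `H` lets `f` and `g` be replaced by the restrictions of `K` to
  -- the two ends of the cylinder.
  generalize H.toContinuousMap = K at h₀ h₁
  subst h₀ h₁
  refine ⟨asIso (homologyCoeff (F.pullbackComp K (cylInclusion X 0)).hom n) ≪≫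
    asIso (homologyCoeff (cylTransport (F.pullback K)) n) ≪≫
    (asIso (homologyCoeff (F.pullbackComp K (cylInclusion X 1)).hom n)).symm, ?_⟩
  rw [homologyMap_comp, homologyMap_comp, homologyMap_cylInclusion]
  simp

end HomotopyInvariance

/-! ### Homotopy equivalences induce isomorphisms -/

section HomotopyEquivalence

variable {X Y : Type u} [TopologicalSpace X] [TopologicalSpace Y]

theorem InducesIso.congr_homotopic {f g : C(X, Y)} {F : LocalSystem Y} (hf : InducesIso f F)
    (h : f.Homotopic g) : InducesIso g F := by
  intro n
  obtain ⟨e, he⟩ := exists_homologyMap_eq_of_homotopic h F n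
  have := hf n
  rw [he] at this
  exact IsIso.of_isIso_comp_left e.hom _

theorem isIso_homologyMap_comp_homologyMap {Z : Type u} [TopologicalSpace Z] {f : C(Y, Z)}
    {g : C(X, Y)} {F : LocalSystem Z} (h : InducesIso (f.comp g) F) (n : ℕ) :
    IsIso (homologyMap g (F.pullback f) n ≫ homologyMap f F n) := by
  have := h n
  rw [homologyMap_comp] at this
  exact IsIso.of_isIso_comp_left (homologyCoeff (F.pullbackComp f g).hom n) _

/-- The map `f_*` occurs with two different coefficient systems, `F` and `g^* f^* F`. The map `g_*`
between them is mono by one homotopy and epi by the other, hence an isomorphism, and then so is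
`f_*` with coefficients `F`. -/
theorem inducesIso_of_homotopy_inverse (f : C(X, Y)) (g : C(Y, X))
    (hfg : (f.comp g).Homotopic (ContinuousMap.id Y))
    (hgf : (g.comp f).Homotopic (ContinuousMap.id X)) (F : LocalSystem Y) : InducesIso f F := by
  have h₁ : InducesIso (f.comp g) F := (inducesIso_id F).congr_homotopic hfg.symm
  have h₂ : InducesIso (g.comp f) (F.pullback f) :=
    (inducesIso_id (F.pullback f)).congr_homotopic hgf.symm
  refine h₁.of_comp_right fun n => ?_
  have := isIso_homologyMap_comp_homologyMap h₁ n
  have := isIso_homologyMap_comp_homologyMap h₂ n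
  have : Mono (homologyMap g (F.pullback f) n) := mono_of_mono _ (homologyMap f F n)
  have : Epi (homologyMap g (F.pullback f) n) :=
    epi_of_epi (homologyMap f ((F.pullback f).pullback g) n) _
  exact isIso_of_mono_of_epi _

theorem _root_.Homeomorph.inducesIso (e : X ≃ₜ Y) (F : LocalSystem Y) :
    InducesIso (e : C(X, Y)) F := by
  refine inducesIso_of_homotopy_inverse _ (e.symm : C(Y, X)) ?_ ?_ F
  · rw [show (e : C(X, Y)).comp (e.symm : C(Y, X)) = ContinuousMap.id Y from
      ContinuousMap.ext e.apply_symm_apply]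
  · rw [show (e.symm : C(Y, X)).comp (e : C(X, Y)) = ContinuousMap.id X from
      ContinuousMap.ext e.symm_apply_apply]

end HomotopyEquivalence

/-! ### Deformation retractions onto embedded subspaces -/

section Retraction

open Topology

/-- A map whose values lie in the range of an embedding factors through it. -/
theorem exists_lift_of_isEmbedding {T X X' : Type*} [TopologicalSpace T] [TopologicalSpace X]
    [TopologicalSpace X'] {α : C(X', X)} (hα : IsEmbedding α) (f : C(T, X))
    (h : ∀ t, f t ∈ Set.range α) : ∃ g : C(T, X'), ∀ t, α (g t) = f t := by
  choose g hg using h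
  refine ⟨⟨g, hα.continuous_iff.2 ?_⟩, hg⟩
  rw [show α ∘ g = f from funext hg]
  exact f.continuous

/-- A homotopy which preserves `U` and ends in the range of an embedding `α` yields a deformation
retraction of `U` to its preimage under `α`. -/
theorem exists_deformation_retraction {X X' : Type*} [TopologicalSpace X] [TopologicalSpace X']
    {α : C(X', X)} (hα : IsEmbedding α) {K : C(unitInterval × X, X)} {U : Set X} {U' : Set X'}
    (hU' : ∀ x, x ∈ U' ↔ α x ∈ U) (h0 : ∀ x, K (0, x) = x)
    (hU : ∀ t, ∀ x ∈ U, K (t, x) ∈ U) (h1 : ∀ x ∈ U, K (1, x) ∈ Set.range α)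
    (hfix : ∀ x, K (1, α x) = α x) {a : C(U', U)} (ha : ∀ x, (a x : X) = α x) :
    ∃ ρ : C(U, U'), (∀ x, α (ρ x) = K (1, x)) ∧ ρ.comp a = ContinuousMap.id U' ∧
      (a.comp ρ).Homotopic (ContinuousMap.id U) := by
  obtain ⟨g, hg⟩ := exists_lift_of_isEmbedding hα
    (K.comp ((ContinuousMap.const U (1 : unitInterval)).prodMk ⟨Subtype.val, by fun_prop⟩))
    fun x => h1 x x.2
  refine ⟨⟨fun x => ⟨g x, (hU' _).2 (by rw [hg]; exact hU _ _ x.2)⟩, by fun_prop⟩, hg, ?_, ?_⟩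
  · ext x
    refine hα.injective ((hg (a x)).trans ?_)
    change K (1, (a x : X)) = α x
    rw [ha, hfix]
  · refine ContinuousMap.Homotopic.symm ⟨⟨⟨fun z => ⟨K (z.1, z.2), hU _ _ z.2.2⟩, by fun_prop⟩,
      fun x => Subtype.ext (h0 x), fun x => Subtype.ext ?_⟩⟩
    exact (hg x).symm.trans (ha ⟨g x, _⟩).symm

end Retraction

/-! ### The Leray condition over one set, and its transfer along a retraction -/

section Leray

variable (𝔈 : CoefficientClass.{u}) {X Y X' Y' : Type u} [TopologicalSpace X] [TopologicalSpace Y]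
  [TopologicalSpace X'] [TopologicalSpace Y']

/-- The condition on the members `U` of the basis in the definition of a Leray homology
fibration. -/
def IsLerayOver (r : C(Y, X)) (U : Set X) : Prop :=
  ContractibleSpace U ∧ ∀ (x : X) (hx : x ∈ U) (F : LocalSystem (Hofib r U)), 𝔈.Mem F →
    InducesIso (fibreInclusion r hx) (F.pullback (preimageToHofib r U))

/-- All open sets satisfying the condition together form a basis as soon as they are cofinal at each
point, so the property can be checked pointwise. -/
theorem isLerayFibration_iff (r : C(Y, X)) :
    IsLerayFibration 𝔈 r ↔ ∀ x : X, ∀ V : Set X, x ∈ V → IsOpen V →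
      ∃ U, (IsOpen U ∧ IsLerayOver 𝔈 r U) ∧ x ∈ U ∧ U ⊆ V := by
  constructor
  · rintro ⟨𝓑, h𝓑, hc, h⟩ x V hx hV
    obtain ⟨U, hU, hxU, hUV⟩ := h𝓑.exists_subset_of_mem_open hx hV
    exact ⟨U, ⟨h𝓑.isOpen hU, hc U hU, h U hU⟩, hxU, hUV⟩
  · intro h
    exact ⟨{U | IsOpen U ∧ IsLerayOver 𝔈 r U},
      TopologicalSpace.isTopologicalBasis_of_isOpen_of_nhds (fun U hU => hU.1) h,
      fun U hU => hU.2.1, fun U hU => hU.2.2⟩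

theorem CoefficientClass.mem_pullback {F : LocalSystem Y} (hF : 𝔈.Mem F) (f : C(X, Y)) :
    𝔈.Mem (F.pullback f) :=
  𝔈.mem_of_iso_pullback f (Iso.refl _) hF

/-- The map of homotopy fibres induced by a commutative square. -/
def hofibMap {q : C(Y', X')} {r : C(Y, X)} {α : C(X', X)} {β : C(Y', Y)}
    (h : r.comp β = α.comp q) {U' : Set X'} {U : Set X} (hU : ∀ x ∈ U', α x ∈ U) :
    C(Hofib q U', Hofib r U) where
  toFun z := ⟨(α.comp z.1.1, β z.1.2), hU _ z.2.1,
    (congrArg α z.2.2).trans (DFunLike.congr_fun h z.1.2).symm⟩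
  continuous_toFun := by
    refine Continuous.subtype_mk (Continuous.prodMk ?_ ?_) _
    · exact (ContinuousMap.continuous_postcomp α).comp (continuous_fst.comp continuous_subtype_val)
    · exact β.continuous.comp (continuous_snd.comp continuous_subtype_val)

open Topology

/-- Compatible flows retract `U` to `U'` and `r⁻¹(U)` to `q⁻¹(U')`. Moving the fibre over `x` along
the flow makes its inclusion homotopic to the composite `r⁻¹(x) → q⁻¹(x') → q⁻¹(U') → r⁻¹(U)`. These
maps induce isomorphisms by `hfib`, by the condition over `U'`, and by the retraction, respectively.
-/
theorem IsLerayOver.of_deformation_retraction {q : C(Y', X')} {r : C(Y, X)} {α : C(X', X)}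
    {β : C(Y', Y)} (hsq : r.comp β = α.comp q) (hα : IsEmbedding α) (hβ : IsEmbedding β)
    {U : Set X} {U' : Set X'} (hU' : ∀ x, x ∈ U' ↔ α x ∈ U) (hq : IsLerayOver 𝔈 q U')
    (KX : C(unitInterval × X, X)) (KY : C(unitInterval × Y, Y))
    (hK : ∀ t y, r (KY (t, y)) = KX (t, r y)) (hX0 : ∀ x, KX (0, x) = x)
    (hY0 : ∀ y, KY (0, y) = y) (hU : ∀ t, ∀ x ∈ U, KX (t, x) ∈ U)
    (hX1 : ∀ x ∈ U, KX (1, x) ∈ Set.range α) (hY1 : ∀ y, r y ∈ U → KY (1, y) ∈ Set.range β)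
    (hXfix : ∀ x, KX (1, α x) = α x) (hYfix : ∀ y, KY (1, β y) = β y)
    (hfib : ∀ x ∈ U, ∀ x', α x' = KX (1, x) → ∀ h : C(r ⁻¹' {x}, q ⁻¹' {x'}),
      (∀ y, β (h y) = KY (1, y)) → IsHomologyEquivalence 𝔈 h) :
    IsLerayOver 𝔈 r U := by
  have hsq' : ∀ y, r (β y) = α (q y) := DFunLike.congr_fun hsq
  let a : C(U', U) := ⟨fun x => ⟨α x, (hU' x).1 x.2⟩, by fun_prop⟩
  let b : C(q ⁻¹' U', r ⁻¹' U) := ⟨fun y => ⟨β y, by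
    change r (β y) ∈ U
    rw [hsq' y]
    exact (hU' _).1 y.2⟩, by fun_prop⟩
  obtain ⟨ρ, hρ, hρa, haρ⟩ := exists_deformation_retraction hα hU' hX0 hU hX1 hXfix
    (a := a) fun _ => rfl
  obtain ⟨τ, hτ, hτb, hbτ⟩ := exists_deformation_retraction (U := r ⁻¹' U) (U' := q ⁻¹' U')
    hβ (fun y => by rw [Set.mem_preimage, Set.mem_preimage, hsq', hU']) hY0
    (fun t y hy => by
      rw [Set.mem_preimage, hK]
      exact hU _ _ hy) hY1 hYfix (a := b) fun _ => rfl
  obtain ⟨hc, hq⟩ := hq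
  refine ⟨ContinuousMap.HomotopyEquiv.contractibleSpace
    ⟨ρ, a, haρ, by rw [hρa]⟩, fun x hx F hF => ?_⟩
  have hqτ : ∀ y : r ⁻¹' {x}, q (τ (fibreInclusion r hx y)) = ρ ⟨x, hx⟩ := fun y => by
    apply hα.injective
    rw [← hsq', hτ, hK, hρ]
    exact congrArg (fun z => KX (1, z)) y.2
  let h : C(r ⁻¹' {x}, q ⁻¹' {(ρ ⟨x, hx⟩ : X')}) :=
    ⟨fun y => ⟨τ (fibreInclusion r hx y), hqτ y⟩, by fun_prop⟩
  have hh : IsHomologyEquivalence 𝔈 h := hfib x hx _ (hρ _) h fun y => hτ _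
  -- This square shows that `j^* F`, restricted to `q⁻¹(U')`, again comes from an admissible system
  -- on a homotopy fibre, so that the condition over `U'` applies to it.
  have hcomp : (preimageToHofib r U).comp b =
      (hofibMap hsq fun x => (hU' x).1).comp (preimageToHofib q U') := by
    ext y : 1
    refine Subtype.ext (Prod.ext (ContinuousMap.ext fun _ => ?_) rfl)
    exact hsq' y
  have hb : InducesIso b (F.pullback (preimageToHofib r U)) :=
    inducesIso_of_homotopy_inverse b τ hbτ (by rw [hτb]) _
  have hi : InducesIso (fibreInclusion q (ρ ⟨x, hx⟩).2)
      ((F.pullback (preimageToHofib r U)).pullback b) := by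
    have e := F.pullbackComp (preimageToHofib r U) b
    rw [hcomp] at e
    exact (hq _ _ _ (𝔈.mem_pullback hF _)).of_iso
      ((F.pullbackComp (hofibMap hsq fun x => (hU' x).1) (preimageToHofib q U')).symm ≪≫ e)
  have key := hb.comp (hi.comp (hh _ (𝔈.mem_pullback (𝔈.mem_pullback (𝔈.mem_pullback hF _) _) _)))
  -- The composite is `b ∘ τ` after the inclusion of the fibre, and `b ∘ τ` is homotopic to the
  -- identity.
  exact key.congr_homotopic (hbτ.comp (.refl (fibreInclusion r hx)))

end Leray

/-! ### Topology of the double mapping cylinder: open sets, embeddings, flows -/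

namespace DoubleMappingCylinder

open Topology

variable {X₀ X₁ X₂ : Type u} [TopologicalSpace X₀] [TopologicalSpace X₁] [TopologicalSpace X₂]
  (f₁ : C(X₀, X₁)) (f₂ : C(X₀, X₂))

/-- The inclusion of the left end. -/
def inl : C(X₁, DoubleMappingCylinder f₁ f₂) where
  toFun x := Quot.mk _ (Sum.inl x)
  continuous_toFun := continuous_quot_mk.comp continuous_inl

/-- The map from the cylinder. -/
def mid : C(X₀ × unitInterval, DoubleMappingCylinder f₁ f₂) where
  toFun z := Quot.mk _ (Sum.inr (Sum.inl z))
  continuous_toFun := continuous_quot_mk.comp (continuous_inr.comp continuous_inl)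

/-- The inclusion of the right end. -/
def inr : C(X₂, DoubleMappingCylinder f₁ f₂) where
  toFun x := Quot.mk _ (Sum.inr (Sum.inr x))
  continuous_toFun := continuous_quot_mk.comp (continuous_inr.comp continuous_inr)

/-- The inclusion of the middle space at height `t`. -/
def level (t : unitInterval) : C(X₀, DoubleMappingCylinder f₁ f₂) :=
  (mid f₁ f₂).comp ((ContinuousMap.id _).prodMk (ContinuousMap.const _ t))

theorem mid_zero (x : X₀) : mid f₁ f₂ (x, 0) = inl f₁ f₂ (f₁ x) :=
  Quot.sound (.left x)

theorem mid_one (x : X₀) : mid f₁ f₂ (x, 1) = inr f₁ f₂ (f₂ x) :=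
  Quot.sound (.right x)

variable {f₁ f₂}

theorem ind {P : DoubleMappingCylinder f₁ f₂ → Prop} (hl : ∀ x, P (inl f₁ f₂ x))
    (hm : ∀ x t, P (mid f₁ f₂ (x, t))) (hr : ∀ x, P (inr f₁ f₂ x))
    (m : DoubleMappingCylinder f₁ f₂) : P m :=
  Quot.ind (Sum.rec hl (Sum.rec (fun z => hm z.1 z.2) hr)) m

/-- The subset of the double mapping cylinder made of compatible subsets of the three parts. -/
def glueSet (S₁ : Set X₁) (S₀ : Set (X₀ × unitInterval)) (S₂ : Set X₂)
    (h₁ : ∀ x, (x, 0) ∈ S₀ ↔ f₁ x ∈ S₁) (h₂ : ∀ x, (x, 1) ∈ S₀ ↔ f₂ x ∈ S₂) :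
    Set (DoubleMappingCylinder f₁ f₂) :=
  Quot.lift (Sum.elim S₁ (Sum.elim S₀ S₂)) (by
    rintro _ _ (x | x)
    · exact propext (h₁ x)
    · exact propext (h₂ x))

section glueSet

variable {S₁ : Set X₁} {S₀ : Set (X₀ × unitInterval)} {S₂ : Set X₂}
  {h₁ : ∀ x, (x, 0) ∈ S₀ ↔ f₁ x ∈ S₁} {h₂ : ∀ x, (x, 1) ∈ S₀ ↔ f₂ x ∈ S₂}

theorem isOpen_glueSet (o₁ : IsOpen S₁) (o₀ : IsOpen S₀) (o₂ : IsOpen S₂) :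
    IsOpen (glueSet S₁ S₀ S₂ h₁ h₂) := by
  refine isOpen_coinduced.2 (isOpen_sum_iff.2 ⟨o₁, isOpen_sum_iff.2 ⟨o₀, o₂⟩⟩)

end glueSet

/-- A subset of the left end together with part of the cylinder below height `1`. -/
def leftSet (S : Set X₁) (W : Set (X₀ × unitInterval)) (h : ∀ x, (x, 0) ∈ W ↔ f₁ x ∈ S)
    (h' : ∀ x, (x, 1) ∉ W) : Set (DoubleMappingCylinder f₁ f₂) :=
  glueSet S W ∅ h fun x => iff_of_false (h' x) id

/-- A subset of the open cylinder. -/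
def midSet (W : Set (X₀ × unitInterval)) (h : ∀ x, (x, 0) ∉ W)
    (h' : ∀ x, (x, 1) ∉ W) : Set (DoubleMappingCylinder f₁ f₂) :=
  glueSet ∅ W ∅ (fun x => iff_of_false (h x) id) fun x => iff_of_false (h' x) id

theorem eq_zero_of_mid_eq_inl {z : X₀ × unitInterval} {y : X₁}
    (h : mid f₁ f₂ z = inl f₁ f₂ y) : z.2 = 0 := by
  have : inl f₁ f₂ y ∈ leftSet Set.univ {z | z.2 = 0} (fun _ => iff_of_true rfl trivial)
    (fun _ h => one_ne_zero h) := trivial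
  rw [← h] at this
  exact this

theorem inr_ne_inl {x : X₂} {y : X₁} : inr f₁ f₂ x ≠ inl f₁ f₂ y := by
  intro h
  have : inl f₁ f₂ y ∈ leftSet Set.univ {z | z.2 = 0} (fun _ => iff_of_true rfl trivial)
    (fun _ h => one_ne_zero h) := trivial
  rw [← h] at this
  exact this

/-- Separates points of the quotient: membership in this set unfolds to equality with `(x, t)` on
the cylinder and to falsity on both ends. The next three lemmas read this off. -/
theorem eq_mid_of_mem_singleton {m : DoubleMappingCylinder f₁ f₂} {x : X₀} {t : unitInterval}
    (h0 : 0 < t) (h1 : t < 1) (h : m = mid f₁ f₂ (x, t)) :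
    m ∈ midSet (f₁ := f₁) (f₂ := f₂) {(x, t)} (fun _ e => h0.ne (congrArg Prod.snd e))
      (fun _ e => h1.ne' (congrArg Prod.snd e)) := by
  rw [h]
  exact rfl

theorem mid_injective {z : X₀ × unitInterval} {x : X₀} {t : unitInterval}
    (h0 : 0 < t) (h1 : t < 1) (h : mid f₁ f₂ z = mid f₁ f₂ (x, t)) : z = (x, t) :=
  eq_mid_of_mem_singleton h0 h1 h

theorem inl_ne_mid {y : X₁} {x : X₀} {t : unitInterval}
    (h0 : 0 < t) (h1 : t < 1) : inl f₁ f₂ y ≠ mid f₁ f₂ (x, t) := fun h =>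
  eq_mid_of_mem_singleton h0 h1 h

theorem inr_ne_mid {y : X₂} {x : X₀} {t : unitInterval}
    (h0 : 0 < t) (h1 : t < 1) : inr f₁ f₂ y ≠ mid f₁ f₂ (x, t) := fun h =>
  eq_mid_of_mem_singleton h0 h1 h

variable (f₁ f₂)

/-- An open `V` in `X₁` is the trace of the open set formed by `V` and `f₁⁻¹(V) × [0,1)`. The same
set built from a singleton gives injectivity. -/
theorem isEmbedding_inl : IsEmbedding (inl f₁ f₂) := by
  have aux (S : Set X₁) (x : X₀) : (x, (0 : unitInterval)) ∈ {z : X₀ × unitInterval |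
      f₁ z.1 ∈ S ∧ z.2 < (1 : unitInterval)} ↔ f₁ x ∈ S := and_iff_left zero_lt_one
  have aux' (S : Set X₁) (x : X₀) : (x, (1 : unitInterval)) ∉ {z : X₀ × unitInterval |
      f₁ z.1 ∈ S ∧ z.2 < (1 : unitInterval)} := fun h => lt_irrefl _ h.2
  refine ⟨⟨le_antisymm (continuous_iff_le_induced.1 (inl f₁ f₂).continuous) fun V hV => ?_⟩,
    fun x y h => ?_⟩
  · refine ⟨leftSet V _ (aux V) (aux' V), isOpen_glueSet hV ?_ isOpen_empty, rfl⟩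
    exact (hV.preimage (f₁.continuous.comp continuous_fst)).inter
      ((isOpen_Iio (a := (1 : unitInterval))).preimage continuous_snd)
  · have : inl f₁ f₂ x ∈ leftSet {y} _ (aux {y}) (aux' {y}) := by
      rw [h]
      exact rfl
    exact this

theorem isEmbedding_level {t : unitInterval} (h0 : 0 < t) (h1 : t < 1) :
    IsEmbedding (level f₁ f₂ t) := by
  refine ⟨⟨le_antisymm (continuous_iff_le_induced.1 (level f₁ f₂ t).continuous) fun V hV => ?_⟩,
    fun x y h => congrArg Prod.fst (mid_injective h0 h1 h)⟩
  refine ⟨midSet (V ×ˢ Set.Ioo 0 1) (fun x h => lt_irrefl _ h.2.1) (fun x h => lt_irrefl _ h.2.2),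
    isOpen_glueSet isOpen_empty (hV.prod isOpen_Ioo) isOpen_empty, ?_⟩
  ext x
  exact and_iff_left ⟨h0, h1⟩

/-- Exchange of the two ends. -/
def swap : C(DoubleMappingCylinder f₁ f₂, DoubleMappingCylinder f₂ f₁) where
  toFun := Quot.lift (Sum.elim (inr f₂ f₁)
    (Sum.elim (fun z => mid f₂ f₁ (z.1, unitInterval.symm z.2)) (inl f₂ f₁))) (by
      rintro _ _ (x | x)
      · simpa using mid_one f₂ f₁ x
      · simpa using mid_zero f₂ f₁ x)
  continuous_toFun := by
    refine continuous_quot_lift _ (continuous_sum_dom.2 ⟨(inr f₂ f₁).continuous,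
      continuous_sum_dom.2 ⟨?_, (inl f₂ f₁).continuous⟩⟩)
    exact (mid f₂ f₁).continuous.comp
      (continuous_fst.prodMk (unitInterval.continuous_symm.comp continuous_snd))

theorem swap_swap (m : DoubleMappingCylinder f₁ f₂) : swap f₂ f₁ (swap f₁ f₂ m) = m := by
  induction m using ind with
  | hl x => rfl
  | hm x t => exact congrArg (fun s => mid f₁ f₂ (x, s)) (unitInterval.symm_symm t)
  | hr x => rfl

/-- Exchange of the two ends, as a homeomorphism. -/
def swapHomeomorph : DoubleMappingCylinder f₁ f₂ ≃ₜ DoubleMappingCylinder f₂ f₁ where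
  toFun := swap f₁ f₂
  invFun := swap f₂ f₁
  left_inv := swap_swap f₁ f₂
  right_inv := swap_swap f₂ f₁

/-- The straight line from `t` to `ψ t`. -/
def lineFlow (ψ : C(unitInterval, unitInterval)) : C(unitInterval × unitInterval, unitInterval) where
  toFun z := ⟨(1 - z.1) * z.2 + z.1 * ψ z.2, (convex_Icc (0 : ℝ) 1) z.2.2 (ψ z.2).2
    (sub_nonneg.2 z.1.2.2) z.1.2.1 (sub_add_cancel _ _)⟩
  continuous_toFun := by fun_prop

theorem lineFlow_zero (ψ : C(unitInterval, unitInterval)) (t : unitInterval) :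
    lineFlow ψ (0, t) = t := Subtype.ext (by simp [lineFlow])

theorem lineFlow_one (ψ : C(unitInterval, unitInterval)) (t : unitInterval) :
    lineFlow ψ (1, t) = ψ t := Subtype.ext (by simp [lineFlow])

theorem lineFlow_of_fixed (ψ : C(unitInterval, unitInterval)) {t : unitInterval} (h : ψ t = t)
    (s : unitInterval) : lineFlow ψ (s, t) = t := by
  refine Subtype.ext ?_
  change (1 - (s : ℝ)) * t + s * (ψ t : ℝ) = t
  rw [h]
  ring

/-- The flow on the double mapping cylinder deforming the height by a self-map `ψ` of `[0,1]`. -/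
def flow (ψ : C(unitInterval, unitInterval)) (h0 : ψ 0 = 0) (h1 : ψ 1 = 1) :
    C(unitInterval × DoubleMappingCylinder f₁ f₂, DoubleMappingCylinder f₁ f₂) where
  toFun z := Quot.lift (Sum.elim (inl f₁ f₂)
    (Sum.elim (fun w => mid f₁ f₂ (w.1, lineFlow ψ (z.1, w.2))) (inr f₁ f₂))) (by
      rintro _ _ (x | x)
      · simpa [lineFlow_of_fixed ψ h0] using mid_zero f₁ f₂ x
      · simpa [lineFlow_of_fixed ψ h1] using mid_one f₁ f₂ x) z.2
  continuous_toFun := by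
    -- Since `[0,1]` is locally compact, continuity can be tested before passing to the quotient.
    -- Currying the time variable then allows a check on each summand.
    refine isQuotientMap_quot_mk.continuous_lift_prod_right (f := Quot.mk (CylinderRel f₁ f₂)) ?_
    let e : X₁ ⊕ (X₀ × unitInterval) ⊕ X₂ → C(unitInterval, DoubleMappingCylinder f₁ f₂) :=
      Sum.elim (ContinuousMap.curry ((inl f₁ f₂).comp .fst)) (Sum.elim
        (ContinuousMap.curry ((mid f₁ f₂).comp ⟨fun w : (X₀ × unitInterval) × unitInterval =>
          (w.1.1, lineFlow ψ (w.2, w.1.2)), by fun_prop⟩))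
        (ContinuousMap.curry ((inr f₁ f₂).comp .fst)))
    have he : Continuous e := by
      refine continuous_sum_dom.2 ⟨?_, continuous_sum_dom.2 ⟨?_, ?_⟩⟩ <;>
        exact ContinuousMap.continuous _
    refine ((ContinuousMap.continuous_uncurry_of_continuous ⟨e, he⟩).comp
      continuous_swap).congr ?_
    rintro ⟨s, x | z | x⟩ <;> rfl

section flow

variable {f₁ f₂} {ψ : C(unitInterval, unitInterval)} {h0 : ψ 0 = 0} {h1 : ψ 1 = 1}

theorem flow_mid (s : unitInterval) (x : X₀) (t : unitInterval) :
    flow f₁ f₂ ψ h0 h1 (s, mid f₁ f₂ (x, t)) = mid f₁ f₂ (x, lineFlow ψ (s, t)) :=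
  rfl

theorem flow_zero (m : DoubleMappingCylinder f₁ f₂) : flow f₁ f₂ ψ h0 h1 (0, m) = m := by
  induction m using ind with
  | hl x => rfl
  | hm x t => rw [flow_mid, lineFlow_zero]
  | hr x => rfl

end flow

end DoubleMappingCylinder

/-- For every height `c` strictly between `0` and `1` and every small `ε`, there is a self-map of
`[0,1]` fixing the ends and collapsing the `ε`-neighbourhood of `c` to `c`. -/
theorem exists_collapse (c : unitInterval) {ε : ℝ} (hε : 0 < ε) (h : ε < c) (h' : ε < 1 - c) :
    ∃ ψ : C(unitInterval, unitInterval), ψ 0 = 0 ∧ ψ 1 = 1 ∧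
      ∀ t : unitInterval, |(t : ℝ) - c| < ε → ψ t = c := by
  -- Piecewise linear: constantly `c` within `ε` of `c`, with outer slopes chosen to reach `0` and
  -- `1` at the ends.
  refine ⟨⟨fun t => Set.projIcc 0 1 zero_le_one (c + (1 - c) / (1 - c - ε) * max 0 (t - c - ε) -
    c / (c - ε) * max 0 (c - ε - t)), by fun_prop⟩, ?_, ?_, fun t ht => ?_⟩
  · have h1 : max 0 ((0 : ℝ) - c - ε) = 0 := max_eq_left (by linarith)
    have h2 : max 0 ((c : ℝ) - ε - 0) = c - ε := (max_eq_right (by linarith)).trans (sub_zero _)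
    have h3 : (c : ℝ) - ε ≠ 0 := (sub_pos.2 h).ne'
    simp only [ContinuousMap.coe_mk, Set.Icc.coe_zero, h1, h2, div_mul_cancel₀ _ h3, mul_zero,
      add_zero, sub_self]
    exact Set.projIcc_left (zero_le_one (α := ℝ))
  · have h1 : max 0 ((1 : ℝ) - c - ε) = 1 - c - ε := max_eq_right (by linarith)
    have h2 : max 0 ((c : ℝ) - ε - 1) = 0 := max_eq_left (by linarith)
    have h3 : (1 : ℝ) - c - ε ≠ 0 := (sub_pos.2 h').ne'
    simp only [ContinuousMap.coe_mk, Set.Icc.coe_one, h1, h2, div_mul_cancel₀ _ h3, mul_zero,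
      sub_zero, add_sub_cancel]
    exact Set.projIcc_right (zero_le_one (α := ℝ))
  · rw [abs_lt] at ht
    have h1 : max 0 ((t : ℝ) - c - ε) = 0 := max_eq_left (by linarith)
    have h2 : max 0 ((c : ℝ) - ε - t) = 0 := max_eq_left (by linarith)
    simp [h1, h2]

/-! ### Comparison of fibres -/

section Fibres

open Topology

variable {𝔈 : CoefficientClass.{u}} {X Y X' Y' Z : Type u} [TopologicalSpace X]
  [TopologicalSpace Y] [TopologicalSpace X'] [TopologicalSpace Y'] [TopologicalSpace Z]

/-- In a square of embeddings which is surjective on the fibre over `x`, the induced map of fibres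
induces isomorphisms on homology. -/
theorem exists_fibre_inducesIso {q : C(Y', X')} {r : C(Y, X)} {α : C(X', X)} {β : C(Y', Y)}
    (hsq : r.comp β = α.comp q) (hα : Function.Injective α) (hβ : IsEmbedding β) (x : X')
    (hs : ∀ y, r y = α x → y ∈ Set.range β) :
    ∃ k : C(q ⁻¹' {x}, r ⁻¹' {α x}), (∀ e, (k e : Y) = β e) ∧ ∀ F, InducesIso k F := by
  have hsq' : ∀ y, r (β y) = α (q y) := DFunLike.congr_fun hsq
  let k : C(q ⁻¹' {x}, r ⁻¹' {α x}) :=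
    ⟨fun e => ⟨β e, (hsq' e).trans (congrArg α e.2)⟩, by fun_prop⟩
  have hk : IsEmbedding k := by
    refine IsEmbedding.of_comp k.continuous continuous_subtype_val ?_
    exact hβ.comp IsEmbedding.subtypeVal
  have hk' : Function.Surjective k := by
    rintro ⟨y, hy⟩
    obtain ⟨e, rfl⟩ := hs y hy
    exact ⟨⟨e, hα ((hsq' e).symm.trans hy)⟩, rfl⟩
  exact ⟨k, fun _ => rfl, (hk.toHomeomorphOfSurjective hk').inducesIso⟩

/-- Used with `k` the identification of a fibre of `p₀` or `p₁` with a fibre of the cylinder map.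
Collapse maps become recognisable after composing with it. -/
theorem IsHomologyEquivalence.of_comp {f : C(Y, Z)} {k : C(X, Y)} (hk : ∀ F, InducesIso k F)
    (h : IsHomologyEquivalence 𝔈 (f.comp k)) : IsHomologyEquivalence 𝔈 f := fun F hF =>
  InducesIso.of_comp_right (h F hF) (hk _)

theorem isHomologyEquivalence_id : IsHomologyEquivalence 𝔈 (ContinuousMap.id X) := fun F _ =>
  inducesIso_id F

end Fibres

open Topology DoubleMappingCylinder

/-! ### Leray neighbourhoods in the double mapping cylinder -/

section Cylinder

variable {𝔈 : CoefficientClass.{u}} {E₀ E₁ E₂ B₀ B₁ B₂ : Type u}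
  [TopologicalSpace E₀] [TopologicalSpace E₁] [TopologicalSpace E₂]
  [TopologicalSpace B₀] [TopologicalSpace B₁] [TopologicalSpace B₂]
  {p₀ : C(E₀, B₀)} {p₁ : C(E₁, B₁)} {p₂ : C(E₂, B₂)}
  {g₁ : C(E₀, E₁)} {g₂ : C(E₀, E₂)} {f₁ : C(B₀, B₁)} {f₂ : C(B₀, B₂)}
  (h₁ : p₁.comp g₁ = f₁.comp p₀) (h₂ : p₂.comp g₂ = f₂.comp p₀)

theorem cylinderMap_comp_inl :
    (cylinderMap h₁ h₂).comp (inl g₁ g₂) = (inl f₁ f₂).comp p₁ := rfl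

theorem cylinderMap_comp_level (t : unitInterval) :
    (cylinderMap h₁ h₂).comp (level g₁ g₂ t) = (level f₁ f₂ t).comp p₀ := rfl

theorem cylinderMap_comp_swap :
    (cylinderMap h₁ h₂).comp (swap g₂ g₁) = (swap f₂ f₁).comp (cylinderMap h₂ h₁) := by
  ext m
  induction m using DoubleMappingCylinder.ind with
  | hl x => rfl
  | hm x t => rfl
  | hr x => rfl

theorem cylinderMap_flow {ψ : C(unitInterval, unitInterval)} {h0 : ψ 0 = 0} {h1 : ψ 1 = 1}
    (s : unitInterval) (m : DoubleMappingCylinder g₁ g₂) :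
    cylinderMap h₁ h₂ (flow g₁ g₂ ψ h0 h1 (s, m)) =
      flow f₁ f₂ ψ h0 h1 (s, cylinderMap h₁ h₂ m) := by
  induction m using DoubleMappingCylinder.ind with
  | hl x => rfl
  | hm x t => rfl
  | hr x => rfl

theorem mem_range_inl_of_cylinderMap_eq {m : DoubleMappingCylinder g₁ g₂} {b : B₁}
    (h : cylinderMap h₁ h₂ m = inl f₁ f₂ b) : m ∈ Set.range (inl g₁ g₂) := by
  induction m using DoubleMappingCylinder.ind with
  | hl x => exact ⟨x, rfl⟩
  | hm x t =>
    obtain rfl : t = 0 := eq_zero_of_mid_eq_inl h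
    exact ⟨g₁ x, (mid_zero g₁ g₂ x).symm⟩
  | hr x => exact (inr_ne_inl h).elim

theorem mem_range_level_of_cylinderMap_eq {m : DoubleMappingCylinder g₁ g₂} {b : B₀}
    {t : unitInterval} (h0 : 0 < t) (h1 : t < 1)
    (h : cylinderMap h₁ h₂ m = level f₁ f₂ t b) : m ∈ Set.range (level g₁ g₂ t) := by
  induction m using DoubleMappingCylinder.ind with
  | hl x => exact (inl_ne_mid h0 h1 h).elim
  | hm x s =>
    obtain rfl : s = t := congrArg Prod.snd (mid_injective h0 h1 h)
    exact ⟨x, rfl⟩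
  | hr x => exact (inr_ne_mid h0 h1 h).elim

/-- The inclusion of `p₀⁻¹(b)` into the fibre over `(b, t)`. -/
theorem exists_level_fibre_inducesIso (b : B₀) {t : unitInterval} (h0 : 0 < t) (h1 : t < 1) :
    ∃ k : C(p₀ ⁻¹' {b}, cylinderMap h₁ h₂ ⁻¹' {level f₁ f₂ t b}),
      (∀ e, (k e : DoubleMappingCylinder g₁ g₂) = level g₁ g₂ t e) ∧ ∀ F, InducesIso k F :=
  exists_fibre_inducesIso (cylinderMap_comp_level h₁ h₂ t)
    (isEmbedding_level f₁ f₂ h0 h1).injective (isEmbedding_level g₁ g₂ h0 h1) b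
    fun _ => mem_range_level_of_cylinderMap_eq h₁ h₂ h0 h1

/-- Vertical collapse onto `U₁`. The assumption on `g₁` is what handles the fibres over points of
positive height. -/
theorem isLerayOver_left {U₁ : Set B₁} {W : Set (B₀ × unitInterval)}
    (hW : ∀ x, (x, 0) ∈ W ↔ f₁ x ∈ U₁) (hW' : ∀ z ∈ W, f₁ z.1 ∈ U₁ ∧ (z.2 : ℝ) < 1 / 2)
    (hstar : ∀ x t s, (x, t) ∈ W → s ≤ t → (x, s) ∈ W) (hp₁ : IsLerayOver 𝔈 p₁ U₁)
    (hg₁ : ∀ b : B₀, IsHomologyEquivalence 𝔈 (fibreMap h₁ b)) :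
    IsLerayOver 𝔈 (cylinderMap h₁ h₂) (leftSet (f₂ := f₂) U₁ W hW fun x h => by
      have := (hW' _ h).2
      norm_num at this) := by
  -- Zero on `[0, 1/2]`, then linear up to `1`; the bound `1 / 2` in `hW'` keeps `W` over the flat
  -- part.
  let ψ : C(unitInterval, unitInterval) :=
    ⟨fun t => Set.projIcc 0 1 zero_le_one (2 * (t : ℝ) - 1), by fun_prop⟩
  have hψ : ∀ t : unitInterval, (t : ℝ) < 1 / 2 → ψ t = 0 := fun t ht =>
    Set.projIcc_of_le_left (zero_le_one (α := ℝ)) (by linarith)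
  have hψ0 : ψ 0 = 0 := hψ 0 (by norm_num)
  have hψ1 : ψ 1 = 1 := Set.projIcc_of_right_le (zero_le_one (α := ℝ)) (by norm_num)
  have hline : ∀ s t : unitInterval, (t : ℝ) < 1 / 2 → lineFlow ψ (s, t) ≤ t := fun s t ht => by
    change (1 - (s : ℝ)) * t + s * (ψ t : ℝ) ≤ t
    rw [hψ t ht]
    have := mul_nonneg s.2.1 t.2.1
    simp only [Set.Icc.coe_zero, mul_zero, add_zero]
    linarith
  have hend : ∀ t : unitInterval, (t : ℝ) < 1 / 2 → lineFlow ψ (1, t) = 0 := fun t ht =>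
    (lineFlow_one ψ t).trans (hψ t ht)
  refine IsLerayOver.of_deformation_retraction 𝔈 (cylinderMap_comp_inl h₁ h₂)
    (isEmbedding_inl f₁ f₂) (isEmbedding_inl g₁ g₂) (fun _ => Iff.rfl) hp₁
    (flow f₁ f₂ ψ hψ0 hψ1) (flow g₁ g₂ ψ hψ0 hψ1) (cylinderMap_flow h₁ h₂) flow_zero flow_zero
    ?_ ?_ ?_ (fun _ => rfl) (fun _ => rfl) ?_
  · intro s x hx
    induction x using DoubleMappingCylinder.ind with
    | hl x => exact hx
    | hm x t => exact hstar x t _ hx (hline s t (hW' _ hx).2)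
    | hr x => exact hx
  · intro x hx
    induction x using DoubleMappingCylinder.ind with
    | hl x => exact ⟨x, rfl⟩
    | hm x t => exact ⟨f₁ x, by rw [flow_mid, hend t (hW' _ hx).2, mid_zero]⟩
    | hr x => exact hx.elim
  · intro y hy
    induction y using DoubleMappingCylinder.ind with
    | hl x => exact ⟨x, rfl⟩
    | hm x t => exact ⟨g₁ x, by rw [flow_mid, hend t (hW' (p₀ x, t) hy).2, mid_zero]⟩
    | hr x => exact hy.elim
  · have hleft : ∀ b x', inl f₁ f₂ x' = inl f₁ f₂ b →
        ∀ h : C(cylinderMap h₁ h₂ ⁻¹' {inl f₁ f₂ b}, p₁ ⁻¹' {x'}),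
        (∀ y, inl g₁ g₂ (h y) = flow g₁ g₂ ψ hψ0 hψ1 (1, y)) → IsHomologyEquivalence 𝔈 h := by
      intro b x' hx' h hh
      obtain rfl := (isEmbedding_inl f₁ f₂).injective hx'
      obtain ⟨k, hk, hk'⟩ := exists_fibre_inducesIso (cylinderMap_comp_inl h₁ h₂)
        (isEmbedding_inl f₁ f₂).injective (isEmbedding_inl g₁ g₂) x'
        fun _ => mem_range_inl_of_cylinderMap_eq h₁ h₂
      refine IsHomologyEquivalence.of_comp hk' ?_
      rw [show h.comp k = ContinuousMap.id _ from ContinuousMap.ext fun e =>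
        Subtype.ext ((isEmbedding_inl g₁ g₂).injective ((hh (k e)).trans (by rw [hk]; rfl)))]
      exact isHomologyEquivalence_id
    intro x hx
    induction x using DoubleMappingCylinder.ind with
    | hl b => exact hleft b
    | hm b t =>
      -- At height `0` the point is glued to `f₁ b`, and its fibre is that of `p₁` rather than that
      -- of `p₀`.
      obtain rfl | h0 := eq_or_lt_of_le (unitInterval.nonneg' : 0 ≤ t)
      · rw [mid_zero]
        exact hleft (f₁ b)
      · have ht : (t : ℝ) < 1 / 2 := (hW' _ hx).2
        have h1 : t < 1 := Subtype.coe_lt_coe.1 (ht.trans (by norm_num))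
        intro x' hx' h hh
        rw [flow_mid, hend t ht, mid_zero] at hx'
        obtain rfl := (isEmbedding_inl f₁ f₂).injective hx'
        obtain ⟨k, hk, hk'⟩ := exists_level_fibre_inducesIso h₁ h₂ b h0 h1
        refine IsHomologyEquivalence.of_comp hk' ?_
        rw [show h.comp k = fibreMap h₁ b from ContinuousMap.ext fun e =>
          Subtype.ext ((isEmbedding_inl g₁ g₂).injective ((hh (k e)).trans (by
            rw [hk]
            change flow g₁ g₂ ψ hψ0 hψ1 (1, mid g₁ g₂ (e, t)) = inl g₁ g₂ (g₁ e)
            rw [flow_mid, hend t ht, mid_zero])))]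
        exact hg₁ b
    | hr x => exact hx.elim

/-- Collapse onto level `c`. All fibres in the band are copies of fibres of `p₀`, and the collapse
only changes their height. -/
theorem isLerayOver_mid {U₀ : Set B₀} (hp₀ : IsLerayOver 𝔈 p₀ U₀) (c : unitInterval) {ε : ℝ}
    (hε : 0 < ε) (hc : ε < c) (hc' : ε < 1 - c) :
    IsLerayOver 𝔈 (cylinderMap h₁ h₂)
      (midSet (f₁ := f₁) (f₂ := f₂) (U₀ ×ˢ {t : unitInterval | |(t : ℝ) - c| < ε})
        (fun x h => by
          have := (abs_lt.1 (show |((0 : unitInterval) : ℝ) - c| < ε from h.2)).1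
          simp only [Set.Icc.coe_zero] at this
          linarith)
        (fun x h => by
          have := (abs_lt.1 (show |((1 : unitInterval) : ℝ) - c| < ε from h.2)).2
          simp only [Set.Icc.coe_one] at this
          linarith)) := by
  obtain ⟨ψ, hψ0, hψ1, hψ⟩ := exists_collapse c hε hc hc'
  have hψc : ψ c = c := hψ c (by simpa using hε)
  have c0 : 0 < c := Subtype.coe_lt_coe.1 (hε.trans hc)
  have c1 : c < 1 := Subtype.coe_lt_coe.1 (by
    simp only [Set.Icc.coe_one]
    linarith)
  have hend : ∀ t : unitInterval, |(t : ℝ) - c| < ε → lineFlow ψ (1, t) = c := fun t ht =>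
    (lineFlow_one ψ t).trans (hψ t ht)
  refine IsLerayOver.of_deformation_retraction 𝔈 (cylinderMap_comp_level h₁ h₂ c)
    (isEmbedding_level f₁ f₂ c0 c1) (isEmbedding_level g₁ g₂ c0 c1) ?_ hp₀
    (flow f₁ f₂ ψ hψ0 hψ1) (flow g₁ g₂ ψ hψ0 hψ1) (cylinderMap_flow h₁ h₂) flow_zero flow_zero
    ?_ ?_ ?_ ?_ ?_ ?_
  · intro x
    exact (and_iff_left (by simpa using hε)).symm
  · intro s x hx
    induction x using DoubleMappingCylinder.ind with
    | hl x => exact hx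
    | hm x t =>
      refine ⟨hx.1, ?_⟩
      change |(1 - (s : ℝ)) * t + s * (ψ t : ℝ) - c| < ε
      -- The flow multiplies the signed distance to `c` by `1 - s`, so it stays in the band.
      rw [hψ t hx.2, show (1 - (s : ℝ)) * t + s * c - c = (1 - s) * (t - c) by ring, abs_mul,
        abs_of_nonneg (sub_nonneg.2 s.2.2)]
      exact (mul_le_of_le_one_left (abs_nonneg _) (sub_le_self _ s.2.1)).trans_lt hx.2
    | hr x => exact hx
  · intro x hx
    induction x using DoubleMappingCylinder.ind with
    | hl x => exact hx.elim
    | hm x t => exact ⟨x, by rw [flow_mid, hend t hx.2]; rfl⟩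
    | hr x => exact hx.elim
  · intro y hy
    induction y using DoubleMappingCylinder.ind with
    | hl x => exact hy.elim
    | hm x t => exact ⟨x, by rw [flow_mid, hend t hy.2]; rfl⟩
    | hr x => exact hy.elim
  · exact fun x => congrArg (fun t => mid f₁ f₂ (x, t)) (lineFlow_of_fixed ψ hψc 1)
  · exact fun x => congrArg (fun t => mid g₁ g₂ (x, t)) (lineFlow_of_fixed ψ hψc 1)
  · intro x hx
    induction x using DoubleMappingCylinder.ind with
    | hl x => exact hx.elim
    | hr x => exact hx.elim
    | hm b t =>
      have ht : |(t : ℝ) - c| < ε := hx.2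
      have h0 : 0 < t := Subtype.coe_lt_coe.1 (by
        have := (abs_lt.1 ht).1
        simp only [Set.Icc.coe_zero]
        linarith)
      have h1 : t < 1 := Subtype.coe_lt_coe.1 (by
        have := (abs_lt.1 ht).2
        simp only [Set.Icc.coe_one]
        linarith)
      intro x' hx' h hh
      rw [flow_mid, hend t ht] at hx'
      obtain rfl := (isEmbedding_level f₁ f₂ c0 c1).injective hx'
      obtain ⟨k, hk, hk'⟩ := exists_level_fibre_inducesIso h₁ h₂ x' h0 h1
      refine IsHomologyEquivalence.of_comp hk' ?_
      rw [show h.comp k = ContinuousMap.id _ from ContinuousMap.ext fun e =>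
        Subtype.ext ((isEmbedding_level g₁ g₂ c0 c1).injective ((hh (k e)).trans (by
          rw [hk]
          change flow g₁ g₂ ψ hψ0 hψ1 (1, mid g₁ g₂ (e, t)) = mid g₁ g₂ (e, c)
          rw [flow_mid, hend t ht])))]
      exact isHomologyEquivalence_id

/-- A homeomorphism of squares is a deformation retraction with the stationary flow `.snd`. -/
theorem isLerayOver_swap {U : Set (DoubleMappingCylinder f₂ f₁)}
    (h : IsLerayOver 𝔈 (cylinderMap h₂ h₁) U) :
    IsLerayOver 𝔈 (cylinderMap h₁ h₂) (swap f₁ f₂ ⁻¹' U) := by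
  refine IsLerayOver.of_deformation_retraction 𝔈 (cylinderMap_comp_swap h₁ h₂)
    (swapHomeomorph f₂ f₁).isEmbedding (swapHomeomorph g₂ g₁).isEmbedding ?_ h
    .snd .snd (fun _ _ => rfl) (fun _ => rfl) (fun _ => rfl) (fun _ _ hx => hx)
    (fun x _ => (swapHomeomorph f₂ f₁).surjective x)
    (fun x _ => (swapHomeomorph g₂ g₁).surjective x) (fun _ => rfl) (fun _ => rfl) ?_
  · intro x
    rw [Set.mem_preimage, swap_swap]
  · rintro _ - x' rfl h hh
    obtain ⟨k, hk, hk'⟩ := exists_fibre_inducesIso (cylinderMap_comp_swap h₁ h₂)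
      (swapHomeomorph f₂ f₁).injective (swapHomeomorph g₂ g₁).isEmbedding x'
      fun y _ => (swapHomeomorph g₂ g₁).surjective y
    refine IsHomologyEquivalence.of_comp hk' ?_
    rw [show h.comp k = ContinuousMap.id _ from ContinuousMap.ext fun e =>
      Subtype.ext ((swapHomeomorph g₂ g₁).injective ((hh (k e)).trans (hk e)))]
    exact isHomologyEquivalence_id

/-- As `s` varies, `min s t` runs through `[0, t]`, so this says that the whole segment below the
point lies in `O`. The complement is the projection of a closed set along the compact factor
`[0,1]`. -/
theorem isOpen_setOf_forall_min_mem {X : Type*} [TopologicalSpace X]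
    {O : Set (X × unitInterval)} (hO : IsOpen O) :
    IsOpen {z : X × unitInterval | ∀ s : unitInterval, (z.1, min s z.2) ∈ O} := by
  have h : IsClosed {w : (X × unitInterval) × unitInterval | (w.1.1, min w.2 w.1.2) ∉ O} :=
    hO.isClosed_compl.preimage (f := fun w : (X × unitInterval) × unitInterval =>
      (w.1.1, min w.2 w.1.2)) (by fun_prop)
  convert! (isClosedMap_fst_of_compactSpace _ h).isOpen_compl using 1
  ext z
  simp

theorem exists_isLerayOver_inl (hp₁ : IsLerayFibration 𝔈 p₁)
    (hg₁ : ∀ b : B₀, IsHomologyEquivalence 𝔈 (fibreMap h₁ b)) (b : B₁)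
    {V : Set (DoubleMappingCylinder f₁ f₂)} (hb : inl f₁ f₂ b ∈ V) (hV : IsOpen V) :
    ∃ U, (IsOpen U ∧ IsLerayOver 𝔈 (cylinderMap h₁ h₂) U) ∧ inl f₁ f₂ b ∈ U ∧ U ⊆ V := by
  obtain ⟨U₁, ⟨hU₁, hL⟩, hbU, hUV⟩ := (isLerayFibration_iff 𝔈 p₁).1 hp₁ b (inl f₁ f₂ ⁻¹' V) hb
    (hV.preimage (inl f₁ f₂).continuous)
  -- The heights admitted depend on the point, since `V` need not contain a uniform collar over
  -- `f₁⁻¹(U₁)`. Requiring whole segments in `V` makes `W` stable under lowering the height.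
  let W : Set (B₀ × unitInterval) := {z | (f₁ z.1 ∈ U₁ ∧ (z.2 : ℝ) < 1 / 2) ∧
    ∀ s : unitInterval, (z.1, min s z.2) ∈ mid f₁ f₂ ⁻¹' V}
  have hW0 : ∀ x, (x, 0) ∈ W ↔ f₁ x ∈ U₁ := fun x => by
    refine ⟨fun h => h.1.1, fun h => ⟨⟨h, by norm_num⟩, fun s => ?_⟩⟩
    rw [min_eq_right unitInterval.nonneg', Set.mem_preimage, mid_zero]
    exact hUV h
  have hstar : ∀ x t s, (x, t) ∈ W → s ≤ t → (x, s) ∈ W := fun x t s h hs => by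
    refine ⟨⟨h.1.1, (Subtype.coe_le_coe.2 hs).trans_lt h.1.2⟩, fun s' => ?_⟩
    have := h.2 (min s' s)
    rwa [min_eq_left ((min_le_right s' s).trans hs)] at this
  refine ⟨_, ⟨?_, isLerayOver_left h₁ h₂ hW0 (fun z hz => hz.1) hstar hL hg₁⟩, hbU, ?_⟩
  · refine isOpen_glueSet hU₁ (((hU₁.preimage (f₁.continuous.comp continuous_fst)).inter
      (isOpen_lt (f := fun z : B₀ × unitInterval => (z.2 : ℝ)) (by fun_prop)
        continuous_const)).inter
        (isOpen_setOf_forall_min_mem (hV.preimage (mid f₁ f₂).continuous))) isOpen_empty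
  · intro x hx
    induction x using DoubleMappingCylinder.ind with
    | hl x => exact hUV hx
    | hm x t =>
      have := hx.2 t
      rwa [min_self] at this
    | hr x => exact hx.elim

theorem exists_isLerayOver_mid (hp₀ : IsLerayFibration 𝔈 p₀) (b : B₀) {t : unitInterval}
    (h0 : 0 < t) (h1 : t < 1) {V : Set (DoubleMappingCylinder f₁ f₂)}
    (hb : mid f₁ f₂ (b, t) ∈ V) (hV : IsOpen V) :
    ∃ U, (IsOpen U ∧ IsLerayOver 𝔈 (cylinderMap h₁ h₂) U) ∧ mid f₁ f₂ (b, t) ∈ U ∧ U ⊆ V := by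
  obtain ⟨O, J, hO, hJ, hbO, htJ, hOJ⟩ := isOpen_prod_iff.1
    (hV.preimage (mid f₁ f₂).continuous) b t hb
  obtain ⟨U₀, ⟨hU₀, hL⟩, hbU, hUO⟩ := (isLerayFibration_iff 𝔈 p₀).1 hp₀ b O hbO hO
  obtain ⟨δ, hδ, hδJ⟩ := Metric.isOpen_iff.1 hJ t htJ
  have t0 : (0 : ℝ) < t := Subtype.coe_lt_coe.2 h0
  have t1 : (0 : ℝ) < 1 - t := sub_pos.2 (Subtype.coe_lt_coe.2 h1)
  -- Below `δ` so that the band lies in `J`, and below `t` and `1 - t` so that it avoids both ends.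
  obtain ⟨ε, hε, hε'⟩ := exists_between (lt_min hδ (lt_min t0 t1))
  obtain ⟨e1, e2⟩ := lt_min_iff.1 hε'
  obtain ⟨e2, e3⟩ := lt_min_iff.1 e2
  refine ⟨_, ⟨?_, isLerayOver_mid h₁ h₂ hL t hε e2 e3⟩, ⟨hbU, by simpa using hε⟩, ?_⟩
  · exact isOpen_glueSet isOpen_empty (hU₀.prod (isOpen_lt (by fun_prop) continuous_const))
      isOpen_empty
  · intro x hx
    induction x using DoubleMappingCylinder.ind with
    | hl x => exact hx.elim
    | hm x s => exact hOJ ⟨hUO hx.1, hδJ (lt_trans hx.2 e1)⟩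
    | hr x => exact hx.elim

end Cylinder
end TwistedHomology
end

/-! ### Assembling the neighbourhoods at all points -/

open TwistedHomology DoubleMappingCylinder in
theorem mainTheorem8 (𝔈 : TwistedHomology.CoefficientClass.{u})
    {E₀ E₁ E₂ B₀ B₁ B₂ : Type u}
    [TopologicalSpace E₀] [TopologicalSpace E₁] [TopologicalSpace E₂]
    [TopologicalSpace B₀] [TopologicalSpace B₁] [TopologicalSpace B₂]
    (p₀ : C(E₀, B₀)) (p₁ : C(E₁, B₁)) (p₂ : C(E₂, B₂))
    (g₁ : C(E₀, E₁)) (g₂ : C(E₀, E₂)) (f₁ : C(B₀, B₁)) (f₂ : C(B₀, B₂))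
    (h₁ : p₁.comp g₁ = f₁.comp p₀) (h₂ : p₂.comp g₂ = f₂.comp p₀)
    (hp₀ : TwistedHomology.IsLerayFibration 𝔈 p₀)
    (hp₁ : TwistedHomology.IsLerayFibration 𝔈 p₁)
    (hp₂ : TwistedHomology.IsLerayFibration 𝔈 p₂)
    (hg₁ : ∀ b : B₀, TwistedHomology.IsHomologyEquivalence 𝔈 (TwistedHomology.fibreMap h₁ b))
    (hg₂ : ∀ b : B₀, TwistedHomology.IsHomologyEquivalence 𝔈 (TwistedHomology.fibreMap h₂ b)) :
    TwistedHomology.IsLerayFibration 𝔈 (TwistedHomology.cylinderMap h₁ h₂) := by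
  -- The right end is the left end of the swapped cylinder.
  have hr (b : B₂) (V : Set (DoubleMappingCylinder f₁ f₂)) (hb : inr f₁ f₂ b ∈ V)
      (hV : IsOpen V) : ∃ U, (IsOpen U ∧ IsLerayOver 𝔈 (cylinderMap h₁ h₂) U) ∧
        inr f₁ f₂ b ∈ U ∧ U ⊆ V := by
    obtain ⟨U, ⟨hU, hL⟩, hbU, hUV⟩ := exists_isLerayOver_inl h₂ h₁ hp₂ hg₂ b
      (V := swap f₂ f₁ ⁻¹' V) hb (hV.preimage (swap f₂ f₁).continuous)
    refine ⟨swap f₁ f₂ ⁻¹' U, ⟨hU.preimage (swap f₁ f₂).continuous, isLerayOver_swap h₁ h₂ hL⟩,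
      hbU, fun x hx => ?_⟩
    have := hUV hx
    rwa [Set.mem_preimage, swap_swap] at this
  refine (isLerayFibration_iff 𝔈 _).2 fun x V hx hV => ?_
  induction x using DoubleMappingCylinder.ind with
  | hl b => exact exists_isLerayOver_inl h₁ h₂ hp₁ hg₁ b hx hV
  | hm b t =>
    -- Cylinder points at heights `0` and `1` are points of the ends and need the end
    -- neighbourhoods.
    obtain rfl | h0 := eq_or_lt_of_le (unitInterval.nonneg' : 0 ≤ t)
    · rw [mid_zero] at hx ⊢
      exact exists_isLerayOver_inl h₁ h₂ hp₁ hg₁ (f₁ b) hx hV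
    obtain rfl | h1 := eq_or_lt_of_le (unitInterval.le_one' : t ≤ 1)
    · rw [mid_one] at hx ⊢
      exact hr (f₂ b) V hx hV
    exact exists_isLerayOver_mid h₁ h₂ hp₀ b h0 h1 hx hV
  | hr b => exact hr b V hx hV
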